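/- Let $S\subset\mathbb R^3$ be a surface, i.e. a Borel set with area $0<|S|<\infty$ that is covered, up to a set of zero area, by countably many regular $C^1$ patches (images of open subsets of the plane under $C^1$ immersions); this includes every nonempty compact embedded $C^1$ surface, with or without boundary, and every triangle mesh. Area is the two-dimensional Hausdorff measure $\mathcal H^2$, normalized to agree with Lebesgue measure on planes. A ray is an oriented line $\{p+td:t\in\mathbb R\}$ with $d\in S^2$ and $p\in d^\perp$; the space of rays carries the measure $d\ell=dp\,d\sigma(d)$, where $\sigma$ is the surface measure of $S^2$ and $dp$ is Lebesgue measure on $d^\perp$. Let $\mathbf L$ be a compact set of rays that contains all rays meeting $S$, let $\ell_1,\ell_2,\dots$ be independent random rays uniformly distributed in $\mathbf L$ with respect to $d\ell$, and let $k_i$ be the number of points of $\ell_i\cap S$. For every $M$ let $x_{M,1},x_{M,2},\dots$ be random points obtained as follows: given $\ell_1,\dots,\ell_M$ with $\sum_{i\le M}k_i>0$, rays are resampled independently with replacement from $\{\ell_1,\dots,\ell_M\}$, the ray $\ell_i$ with probability $k_i/\sum_{l\le M}k_l$, and $x_{M,j}$ is chosen uniformly at random, independently for different $j$, among the finitely many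 intersections of the $j$-th resampled ray with $S$. (With probability one all $k_i$ are finite and $\sum_{i\le M}k_i>0$ for all large $M$; for the remaining outcomes $x_{M,j}$ is arbitrary.) Then the points are asymptotically uniformly distributed (1-equidistributed) on $S$ in the following sense. 1. For every $j$ and every Borel set $B\subset\mathbb R^3$, $\mathbb P(x_{M,j}\in B)\to|B\cap S|/|S|$ as $M\to\infty$. 2. For every $f:\mathbb R^3\to\mathbb R$ that is integrable on $S$ with respect to area, the uniform-weight Monte Carlo estimator $$I_{M,N}=\frac1N\sum_{j=1}^N|S|\,f(x_{M,j})$$ is a consistent estimator of $\int_S f\,d\mathcal H^2$: it converges to $\int_S f\,d\mathcal H^2$ in probability as $M,N\to\infty$ jointly; and almost surely the limit $I_M=\lim_{N\to\infty}I_{M,N}$ exists for all sufficiently large $M$ and $I_M\to\int_S f\,d\mathcal H^2$ as $M\to\infty$. -/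

import Mathlib

open MeasureTheory ProbabilityTheory Filter Topology Metric
open scoped ENNReal RealInnerProductSpace

noncomputable section

/-- Euclidean three-space. -/
abbrev E3 : Type := EuclideanSpace ℝ (Fin 3)

/-- The space of rays, i.e. of oriented lines `{p + t d | t ∈ ℝ}` of `ℝ³`. A ray is given by its
unit direction `d` and the unique point `p` of the line that is orthogonal to `d`. The topology
and the (Borel) `σ`-algebra are those induced from `S² × ℝ³`. -/
abbrev Ray : Type := {q : sphere (0 : E3) 1 × E3 // ⟪(q.1 : E3), q.2⟫ = 0}

namespace Ray

/-- The unit direction of a ray. -/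
def dir (l : Ray) : E3 := l.1.1

/-- The point of the ray closest to the origin. -/
def base (l : Ray) : E3 := l.1.2

/-- The points of `ℝ³` on the ray. -/
def points (l : Ray) : Set E3 := {x | ∃ t : ℝ, x = l.base + t • l.dir}

/-- The ray with direction `d` through the point `p` of the plane `d^⊥`. -/
def ofPlane (d : sphere (0 : E3) 1) (p : (ℝ ∙ (d : E3))ᗮ) : Ray :=
  ⟨(d, (p : E3)), Submodule.mem_orthogonal_singleton_iff_inner_right.mp p.2⟩

lemma isClosed_range : IsClosed {q : sphere (0 : E3) 1 × E3 | ⟪(q.1 : E3), q.2⟫ = 0} :=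
  isClosed_eq (by fun_prop) continuous_const

instance : StandardBorelSpace Ray := isClosed_range.measurableSet.standardBorel

instance : Nonempty Ray :=
  ⟨⟨(⟨EuclideanSpace.single 0 1, by simp⟩, 0), inner_zero_right _⟩⟩

lemma measurable_ofPlane (d : sphere (0 : E3) 1) : Measurable (ofPlane d) :=
  Measurable.subtype_mk (measurable_const.prodMk measurable_subtype_coe)

/-- The plane of rays with direction `d`, with its Lebesgue measure. -/
def planeMeasure (d : sphere (0 : E3) 1) : Measure Ray :=
  (volume : Measure (ℝ ∙ (d : E3))ᗮ).map (ofPlane d)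

/-- The line through the point `x` with direction `d`. -/
def through (q : sphere (0 : E3) 1 × E3) : Ray :=
  ⟨(q.1, q.2 - ⟪(q.1 : E3), q.2⟫ • (q.1 : E3)), by
    simp [inner_sub_right, inner_smul_right]⟩

lemma measurable_through : Measurable through :=
  Continuous.measurable (by unfold through; fun_prop)

lemma planeMeasure_apply (d : sphere (0 : E3) 1) {A : Set Ray} (hA : MeasurableSet A) :
    planeMeasure d A =
      volume {x : E3 | ⟪(d : E3), x⟫ ∈ Set.Icc (0 : ℝ) 1 ∧ through (d, x) ∈ A} := by
  set K : Submodule ℝ E3 := ℝ ∙ (d : E3)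
  have hd : ‖(d : E3)‖ = 1 := by simp
  have he : MeasurePreserving (fun q : K × Kᗮ => (q.1 : E3) + (q.2 : E3)) := by
    have h1 : MeasurePreserving (WithLp.toLp 2 : K × Kᗮ → WithLp 2 (K × Kᗮ)) :=
      WithLp.volume_preserving_toLp _ _
    have h2 := K.orthogonalDecomposition.symm.measurePreserving.comp h1
    convert h2 using 1
    funext q
    simp
  have hm : MeasurableSet {x : E3 | ⟪(d : E3), x⟫ ∈ Set.Icc (0 : ℝ) 1 ∧ through (d, x) ∈ A} := by
    refine MeasurableSet.inter ?_ ((measurable_through.comp measurable_prodMk_left) hA)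
    exact (Continuous.measurable (by fun_prop)) measurableSet_Icc
  have hunit : volume {k : K | ⟪(d : E3), (k : E3)⟫ ∈ Set.Icc (0 : ℝ) 1} = 1 := by
    have h := (LinearIsometryEquiv.toSpanUnitSingleton (𝕜 := ℝ) (d : E3) hd).measurePreserving
    have hc : Continuous fun k : K => ⟪(d : E3), (k : E3)⟫ := by fun_prop
    have hmk : MeasurableSet {k : K | ⟪(d : E3), (k : E3)⟫ ∈ Set.Icc (0 : ℝ) 1} :=
      hc.measurable measurableSet_Icc
    rw [← h.measure_preimage hmk.nullMeasurableSet]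
    have : (LinearIsometryEquiv.toSpanUnitSingleton (𝕜 := ℝ) (d : E3) hd) ⁻¹'
        {k : K | ⟪(d : E3), (k : E3)⟫ ∈ Set.Icc (0 : ℝ) 1} = Set.Icc 0 1 := by
      ext t
      change ⟪(d : E3), t • (d : E3)⟫ ∈ Set.Icc (0 : ℝ) 1 ↔ _
      simp [inner_smul_right]
    rw [this]
    simp
  have hpre : (fun q : K × Kᗮ => (q.1 : E3) + (q.2 : E3)) ⁻¹'
      {x : E3 | ⟪(d : E3), x⟫ ∈ Set.Icc (0 : ℝ) 1 ∧ through (d, x) ∈ A} =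
      {k : K | ⟪(d : E3), (k : E3)⟫ ∈ Set.Icc (0 : ℝ) 1} ×ˢ (ofPlane d ⁻¹' A) := by
    ext ⟨⟨k, hk⟩, p⟩
    have hp : ⟪(d : E3), (p : E3)⟫ = 0 := Submodule.mem_orthogonal_singleton_iff_inner_right.mp p.2
    obtain ⟨t, rfl⟩ := Submodule.mem_span_singleton.mp hk
    have ht : through (d, t • (d : E3) + (p : E3)) = ofPlane d p := by
      apply Subtype.ext
      simp [through, ofPlane, inner_add_right, inner_smul_right, hp]
    simp [ht, inner_add_right, inner_smul_right, hp]
  rw [← he.measure_preimage hm.nullMeasurableSet, hpre, Measure.volume_eq_prod, Measure.prod_prod,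
    hunit, one_mul, planeMeasure, Measure.map_apply (measurable_ofPlane d) hA]

lemma measurable_planeMeasure : Measurable planeMeasure := by
  refine Measure.measurable_of_measurable_coe _ fun A hA => ?_
  simp_rw [planeMeasure_apply _ hA]
  have hm : MeasurableSet {q : sphere (0 : E3) 1 × E3 |
      ⟪(q.1 : E3), q.2⟫ ∈ Set.Icc (0 : ℝ) 1 ∧ through q ∈ A} := by
    refine MeasurableSet.inter ?_ (measurable_through hA)
    exact (Continuous.measurable (by fun_prop)) measurableSet_Icc
  exact measurable_measure_prodMk_left hm

/-- The motion-invariant measure `dℓ` on rays: the direction is distributed according to the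
surface measure of the unit sphere (of total mass `4π`) and, given the direction `d`, the ray
according to Lebesgue measure on the plane `d^⊥`. -/
def measure : Measure Ray := (volume : Measure E3).toSphere.bind planeMeasure

/-- The number `k(ℓ)` of intersections of the ray `ℓ` with the set `S`. (The value is `0` if there
are infinitely many; for a surface of finite area these rays form a null set.) -/
def numHits (S : Set E3) (l : Ray) : ℕ := (l.points ∩ S).ncard

end Ray

/-- Surface area in `ℝ³`: two-dimensional Hausdorff measure, normalized so that it agrees with
Lebesgue measure on planes. -/
def surfaceMeasure : Measure E3 := Measure.euclideanHausdorffMeasure 2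

/-- The area `|S|` of a set. -/
def area (S : Set E3) : ℝ := (surfaceMeasure S).toReal

/-- Surfaces in `ℝ³`, in the generality of rectifiable sets: Borel sets of positive finite area
that are covered, up to a set of zero area, by countably many regular `C¹` patches (immersed images
of open sets of the plane). This contains the nonempty compact embedded `C¹` surfaces, with or
without boundary, and the triangle meshes and other piecewise `C¹` or non-manifold surfaces. -/
structure IsSurface (S : Set E3) : Prop where
  measurableSet : MeasurableSet S
  area_pos : 0 < surfaceMeasure S
  area_lt_top : surfaceMeasure S < ∞
  exists_patches : ∃ (U : ℕ → Set (EuclideanSpace ℝ (Fin 2)))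
    (φ : ℕ → EuclideanSpace ℝ (Fin 2) → E3),
    (∀ n, IsOpen (U n) ∧ ContDiffOn ℝ 1 (φ n) (U n) ∧
      ∀ u ∈ U n, Function.Injective (fderiv ℝ (φ n) u)) ∧
    surfaceMeasure (S \ ⋃ n, φ n '' U n) = 0

/-- One step of the resampling procedure for given rays `r 0, …, r (M - 1)`: the joint law of the
resampled ray and the selected point. The ray `r i` is drawn with probability
`k(r i) / ∑ l, k(r l)`, and then a point is drawn uniformly from the finite set of intersections of
this ray with `S`. (It is a probability measure as soon as `∑ l, k(r l) ≠ 0`, and `0` otherwise.) -/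
def resampleLaw (S : Set E3) {M : ℕ} (r : Fin M → Ray) : Measure (Ray × E3) :=
  ∑ i, ((Ray.numHits S (r i) : ℝ≥0∞) / ∑ l, (Ray.numHits S (r l) : ℝ≥0∞)) •
    (Measure.dirac (r i)).prod (uniformOn ((r i).points ∩ S))

/-- The Monte Carlo estimator with uniform weights, `(1 / N) ∑_{j < N} |S| f(x_j)`. -/
def uniformEstimator (S : Set E3) (f : E3 → ℝ) (x : ℕ → E3) (N : ℕ) : ℝ :=
  (1 / (N : ℝ)) * ∑ j ∈ Finset.range N, area S * f (x j)

end

/-! Drawing a ray with probability proportional to its number of intersections, and then one of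
these intersections uniformly, makes all intersections of the first `M` rays with `S` equally likely
(`map_snd_resampleLaw`). Hence, given the rays, the points are i.i.d. with law `mix`: the normalized
sum of the counting measures on the sets `ℓ i ∩ S`. The strong law for the rays, applied to a sum
over intersections and to their total number, shows that this random law tends to the normalized
mean of the counting measures. By the Cauchy–Crofton formula `Ray.bind_crossing_eq` that mean is a
constant multiple of area on `S`, and the constant cancels.

The Crofton formula is proved on nearly flat pieces. Let all chords of a compact `K` be almost
orthogonal to a unit vector `n`. Unless a direction `d` is almost orthogonal to `n`, a line of
direction `d` meets `K` at most once, and the lines that do meet it have measure close to `|⟪n, d⟫|`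
times the area of `K`. The integral over `d` does not depend on `n`, by symmetry of the sphere. The
remaining directions form a thin band; there the count integrates to at most the area, because
projections do not increase area. A surface is covered by countably many such pieces up to a null
set, almost no ray meets a null set, and the flatness parameter tends to zero.

Measurability is secured by replacing `S` with a σ-compact `B ⊆ S` of full area, since the rays
meeting a compact set form a compact set.

For fixed `M` the strong law in `N` gives `I_M`, the mean under `mix`. For the joint limit `f` is
truncated: Chebyshev's inequality controls the bounded part uniformly in the law, Markov's
inequality the rest. -/

noncomputable section

/-! ### Rays meeting a set, and projections along a direction -/

namespace Ray

/-- The rays that meet the set `B`. -/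
def hits (B : Set E3) : Set Ray := {l | (l.points ∩ B).Nonempty}

/-- The number of points of `B` on a ray, as an extended nonnegative real. -/
def hitCount (B : Set E3) (l : Ray) : ℝ≥0∞ := Measure.count (l.points ∩ B)

lemma norm_dir (l : Ray) : ‖l.dir‖ = 1 := by simp [dir]

lemma inner_dir_base (l : Ray) : ⟪l.dir, l.base⟫ = 0 := l.2

lemma inner_dir_dir (l : Ray) : ⟪l.dir, l.dir⟫ = 1 := by
  rw [real_inner_self_eq_norm_sq, norm_dir, one_pow]

lemma mem_points_iff {l : Ray} {x : E3} : x ∈ l.points ↔ through (l.1.1, x) = l := by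
  constructor
  · rintro ⟨t, rfl⟩
    apply Subtype.ext
    have h1 := l.inner_dir_base
    have h2 := l.inner_dir_dir
    simp only [dir] at h1 h2
    ext1
    · rfl
    · simp only [through, dir, inner_add_right, inner_smul_right, h1, h2]
      simp [base]
  · intro h
    refine ⟨⟪l.dir, x⟫, ?_⟩
    have h2 : x - ⟪l.dir, x⟫ • l.dir = l.base := by
      have := congrArg (fun l : Ray => l.base) h
      simpa [through, base, dir] using this
    rw [← h2]; simp

lemma continuous_through : Continuous through := by unfold through; fun_prop

lemma mem_points_through (q : sphere (0 : E3) 1 × E3) : q.2 ∈ (through q).points :=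
  mem_points_iff.2 rfl

lemma hits_eq_image (B : Set E3) : hits B = through '' (Set.univ ×ˢ B) := by
  ext l
  constructor
  · rintro ⟨x, hx, hB⟩
    exact ⟨(l.1.1, x), ⟨trivial, hB⟩, mem_points_iff.1 hx⟩
  · rintro ⟨q, ⟨-, hB⟩, rfl⟩
    exact ⟨q.2, mem_points_through q, hB⟩

lemma isCompact_hits {K : Set E3} (hK : IsCompact K) : IsCompact (hits K) := by
  rw [hits_eq_image]
  exact (isCompact_univ.prod hK).image continuous_through

lemma hits_iUnion {ι : Sort*} (B : ι → Set E3) : hits (⋃ i, B i) = ⋃ i, hits (B i) := by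
  ext l
  simp [hits, Set.inter_iUnion]

lemma hits_mono {A B : Set E3} (h : A ⊆ B) : hits A ⊆ hits B :=
  fun _ hl => hl.mono (Set.inter_subset_inter_right _ h)

/-- Compactness of `S²` makes `hits` of a compact set compact. For a Borel set `hits` is a
continuous image and need not be Borel, which is why the counting below is done on σ-compact sets.
-/
lemma measurableSet_hits {B : Set E3} (hB : IsSigmaCompact B) : MeasurableSet (hits B) := by
  obtain ⟨K, hK, rfl⟩ := hB
  rw [hits_iUnion]
  exact .iUnion fun n => (isCompact_hits (hK n)).measurableSet

lemma isClosed_points (l : Ray) : IsClosed l.points := by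
  have : l.points = {x | through (l.1.1, x) = l} := by ext x; exact mem_points_iff
  rw [this]
  exact isClosed_eq (continuous_through.comp (by fun_prop)) continuous_const

lemma measurableSet_points (l : Ray) : MeasurableSet l.points := l.isClosed_points.measurableSet

lemma ofPlane_preimage_hits (d : sphere (0 : E3) 1) (B : Set E3) :
    ofPlane d ⁻¹' hits B = (ℝ ∙ (d : E3))ᗮ.orthogonalProjectionOnto '' B := by
  have key : ∀ x : E3, through (d, x) = ofPlane d ((ℝ ∙ (d : E3))ᗮ.orthogonalProjectionOnto x) := by
    intro x
    apply Subtype.ext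
    simp [through, ofPlane, Submodule.starProjection_orthogonal_val,
      Submodule.starProjection_unit_singleton]
  ext p
  constructor
  · rintro ⟨x, hx, hB⟩
    refine ⟨x, hB, ?_⟩
    have h1 := mem_points_iff.1 hx
    have : through (d, x) = ofPlane d p := h1
    rw [key] at this
    apply Subtype.ext
    exact congrArg (fun l : Ray => l.base) this
  · rintro ⟨x, hB, rfl⟩
    refine ⟨x, ?_, hB⟩
    rw [mem_points_iff]
    exact key x

lemma finrank_orthogonal (d : sphere (0 : E3) 1) :
    Module.finrank ℝ (ℝ ∙ (d : E3))ᗮ = 2 := by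
  have h0 : (d : E3) ≠ 0 := ne_zero_of_mem_unit_sphere d
  have : Fact (Module.finrank ℝ E3 = 2 + 1) := ⟨by simp⟩
  exact Submodule.finrank_orthogonal_span_singleton h0

lemma volume_orthogonal_eq (d : sphere (0 : E3) 1) (A : Set (ℝ ∙ (d : E3))ᗮ) :
    volume A = surfaceMeasure ((↑) '' A : Set E3) := by
  rw [surfaceMeasure, isometry_subtype_coe.euclideanHausdorffMeasure_image,
    ← InnerProductSpace.euclideanHausdorffMeasure_eq_volume, finrank_orthogonal]

lemma surfaceMeasure_image_le {A : Set E3} {f : E3 → E3} {K : NNReal} (hf : LipschitzOnWith K f A) :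
    surfaceMeasure (f '' A) ≤ (K : ℝ≥0∞) ^ 2 * surfaceMeasure A := by
  have h := hf.hausdorffMeasure_image_le (d := 2) (by norm_num)
  simp only [surfaceMeasure, Measure.euclideanHausdorffMeasure_def, Measure.smul_apply]
  rw [mul_smul_comm]
  refine smul_le_smul_of_nonneg_left ?_ bot_le
  simpa using h

lemma planeMeasure_hits (d : sphere (0 : E3) 1) {B : Set E3} (hB : MeasurableSet (hits B)) :
    planeMeasure d (hits B) = surfaceMeasure ((ℝ ∙ (d : E3))ᗮ.starProjection '' B) := by
  rw [planeMeasure, Measure.map_apply (measurable_ofPlane d) hB, ofPlane_preimage_hits,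
    volume_orthogonal_eq, Set.image_image]
  rfl

lemma planeMeasure_hits_le (d : sphere (0 : E3) 1) {B : Set E3} (hB : MeasurableSet (hits B)) :
    planeMeasure d (hits B) ≤ surfaceMeasure B := by
  rw [planeMeasure_hits d hB]
  have h : LipschitzWith 1 (ℝ ∙ (d : E3))ᗮ.starProjection :=
    ContinuousLinearMap.lipschitzWith_of_opNorm_le (Submodule.starProjection_norm_le _)
  simpa using surfaceMeasure_image_le h.lipschitzOnWith

end Ray

lemma IsSigmaCompact.inter_of_t2 {X : Type*} [TopologicalSpace X] [T2Space X] {A B : Set X}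
    (hA : IsSigmaCompact A) (hB : IsSigmaCompact B) : IsSigmaCompact (A ∩ B) := by
  obtain ⟨K, hK, rfl⟩ := hA
  obtain ⟨K', hK', rfl⟩ := hB
  have : (⋃ n, K n) ∩ (⋃ n, K' n) = ⋃ p : ℕ × ℕ, K p.1 ∩ K' p.2 := by
    rw [Set.iUnion_inter_iUnion, Set.iUnion_prod']
  rw [this]
  exact isSigmaCompact_iUnion_of_isCompact _ fun p => (hK _).inter (hK' _)

lemma IsLocallyClosed.isSigmaCompact {X : Type*} [TopologicalSpace X] [LocallyCompactSpace X]
    [SecondCountableTopology X] {A : Set X} (hA : IsLocallyClosed A) : IsSigmaCompact A := by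
  have := hA.locallyCompactSpace
  exact isSigmaCompact_iff_sigmaCompactSpace.2 inferInstance

lemma IsSigmaCompact.measurableSet {X : Type*} [TopologicalSpace X] [T2Space X]
    [MeasurableSpace X] [OpensMeasurableSpace X] {A : Set X} (hA : IsSigmaCompact A) :
    MeasurableSet A := by
  obtain ⟨K, hK, rfl⟩ := hA
  exact .iUnion fun n => (hK n).measurableSet

/-! ### Counting intersections through fine partitions -/

namespace Ray

/-- A partition of space into countably many cells of diameter at most `2 / (m + 1)`. -/
def cell (m i : ℕ) : Set E3 :=
  disjointed (fun i => closedBall (TopologicalSpace.denseSeq E3 i) (1 / (m + 1 : ℝ))) i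

lemma isSigmaCompact_cell (m i : ℕ) : IsSigmaCompact (cell m i) := by
  -- A cell is a closed ball minus finitely many closed balls.
  apply IsLocallyClosed.isSigmaCompact
  rw [cell, disjointed_apply, sdiff_eq]
  refine isClosed_closedBall.isLocallyClosed.inter (IsOpen.isLocallyClosed ?_)
  rw [isOpen_compl_iff, Finset.sup_set_eq_biUnion]
  exact Set.Finite.isClosed_biUnion (Finset.finite_toSet _) fun _ _ => isClosed_closedBall

lemma measurableSet_cell (m i : ℕ) : MeasurableSet (cell m i) :=
  MeasurableSet.disjointed (fun _ => isClosed_closedBall.measurableSet) i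

lemma pairwise_disjoint_cell (m : ℕ) : Pairwise (Function.onFun Disjoint (cell m)) :=
  disjoint_disjointed _

lemma iUnion_cell (m : ℕ) : ⋃ i, cell m i = Set.univ := by
  have h := iUnion_disjointed (f := fun i => closedBall (TopologicalSpace.denseSeq E3 i)
    (1 / (m + 1 : ℝ)))
  rw [show (⋃ i, cell m i) = _ from h, Set.eq_univ_iff_forall]
  intro x
  have hpos : (0 : ℝ) < 1 / (m + 1 : ℝ) := by positivity
  obtain ⟨i, hi⟩ := (TopologicalSpace.denseRange_denseSeq E3).exists_dist_lt x hpos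
  exact Set.mem_iUnion.2 ⟨i, hi.le⟩

lemma dist_le_of_mem_cell {m i : ℕ} {x y : E3} (hx : x ∈ cell m i) (hy : y ∈ cell m i) :
    dist x y ≤ 2 / (m + 1 : ℝ) := by
  have h1 := disjointed_subset _ _ hx
  have h2 := disjointed_subset _ _ hy
  have := dist_triangle_right x y (TopologicalSpace.denseSeq E3 i)
  rw [mem_closedBall] at h1 h2
  calc _ ≤ _ := this
    _ ≤ 1 / (m + 1 : ℝ) + 1 / (m + 1 : ℝ) := add_le_add h1 h2
    _ = _ := by ring

/-- The number of cells in which the ray meets `B`. -/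
def cellCount (B : Set E3) (m : ℕ) (l : Ray) : ℝ≥0∞ :=
  ∑' i, (hits (B ∩ cell m i)).indicator 1 l

lemma measurable_cellCount {B : Set E3} (hB : IsSigmaCompact B) (m : ℕ) :
    Measurable (cellCount B m) :=
  Measurable.tsum fun i => measurable_one.indicator
    (measurableSet_hits (hB.inter_of_t2 (isSigmaCompact_cell m i)))

lemma count_eq_tsum_cell (m : ℕ) {A : Set E3} (hA : MeasurableSet A) :
    Measure.count A = ∑' i, Measure.count (A ∩ cell m i) := by
  rw [← measure_iUnion, ← Set.inter_iUnion, iUnion_cell, Set.inter_univ]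
  · exact fun i j hij => ((pairwise_disjoint_cell m hij).mono Set.inter_subset_right
      Set.inter_subset_right)
  · exact fun i => hA.inter (measurableSet_cell m i)

lemma one_le_count {A : Set E3} (hA : A.Nonempty) : 1 ≤ Measure.count A := by
  obtain ⟨x, hx⟩ := hA
  calc 1 = Measure.count {x} := by simp
    _ ≤ _ := measure_mono (by simpa)

lemma cellCount_le {B : Set E3} (hB : MeasurableSet B) (m : ℕ) (l : Ray) :
    cellCount B m l ≤ hitCount B l := by
  rw [hitCount, count_eq_tsum_cell m (l.measurableSet_points.inter hB)]
  refine ENNReal.tsum_le_tsum fun i => ?_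
  by_cases h : l ∈ hits (B ∩ cell m i)
  · rw [Set.indicator_of_mem h, Pi.one_apply]
    rw [Set.inter_assoc]
    exact one_le_count h
  · simp [Set.indicator_of_notMem h]

/-- Once the cells are smaller than the least distance within `T`, distinct points of `T` lie in
distinct cells. -/
lemma eventually_card_le_cellCount {B : Set E3} {l : Ray} {T : Finset E3}
    (hT : (T : Set E3) ⊆ l.points ∩ B) : ∀ᶠ m in atTop, (T.card : ℝ≥0∞) ≤ cellCount B m l := by
  have hsep : ∀ᶠ m : ℕ in atTop, ∀ x ∈ T, ∀ y ∈ T, x ≠ y → 2 / (m + 1 : ℝ) < dist x y := by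
    rw [Filter.eventually_all_finset]; intro x _
    rw [Filter.eventually_all_finset]; intro y _
    by_cases hxy : x = y
    · simp [hxy]
    have hlim : Tendsto (fun m : ℕ => 2 / (m + 1 : ℝ)) atTop (𝓝 0) := by
      have := tendsto_one_div_add_atTop_nhds_zero_nat.const_mul (2 : ℝ)
      simpa [div_eq_mul_inv] using this
    filter_upwards [hlim.eventually_lt_const (dist_pos.2 hxy)] with m hm _ using hm
  filter_upwards [hsep] with m hm
  have hc : Measure.count (T : Set E3) = (T.card : ℝ≥0∞) := Measure.count_apply_finset T
  rw [← hc, count_eq_tsum_cell m T.measurableSet]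
  refine ENNReal.tsum_le_tsum fun i => ?_
  rcases Set.eq_empty_or_nonempty ((T : Set E3) ∩ cell m i) with h | ⟨x, hxT, hxc⟩
  · simp [h]
  · have h1 : (T : Set E3) ∩ cell m i = {x} := by
      refine Set.Subset.antisymm (fun y hy => ?_) (by simpa using ⟨hxT, hxc⟩)
      by_contra hne
      exact absurd (dist_le_of_mem_cell hy.2 hxc) (not_le.2 (hm y hy.1 x hxT hne))
    have h2 : l ∈ hits (B ∩ cell m i) := ⟨x, (hT hxT).1, (hT hxT).2, hxc⟩
    rw [h1, Set.indicator_of_mem h2]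
    simp

/-- The partitions for different `m` do not refine one another, so `cellCount` need not be monotone
in `m`; a lower limit is enough for Fatou's lemma. -/
lemma hitCount_eq_liminf {B : Set E3} (hB : MeasurableSet B) (l : Ray) :
    hitCount B l = liminf (fun m => cellCount B m l) atTop := by
  apply le_antisymm
  · refine le_of_forall_lt fun a ha => ?_
    obtain ⟨T, hT, haT⟩ : ∃ T : Finset E3, (T : Set E3) ⊆ l.points ∩ B ∧ a < T.card := by
      by_cases hfin : (l.points ∩ B).Finite
      · refine ⟨hfin.toFinset, by simp, ?_⟩
        rwa [hitCount, Measure.count_apply_finite _ hfin] at ha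
      · obtain ⟨n, hn⟩ := ENNReal.exists_nat_gt ha.ne_top
        obtain ⟨T, hT, hc⟩ := Set.Infinite.exists_subset_card_eq hfin n
        exact ⟨T, hT, by rwa [hc]⟩
    exact haT.trans_le (le_liminf_of_le (by isBoundedDefault) (eventually_card_le_cellCount hT))
  · exact liminf_le_of_le (by isBoundedDefault) fun b hb => by
      obtain ⟨m, hm⟩ := hb.exists
      exact hm.trans (cellCount_le hB m l)

lemma measurable_hitCount {B : Set E3} (hB : IsSigmaCompact B) : Measurable (hitCount B) := by
  have : hitCount B = fun l => liminf (fun m => cellCount B m l) atTop :=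
    funext (hitCount_eq_liminf hB.measurableSet)
  rw [this]
  exact Measurable.liminf fun m => measurable_cellCount hB m

/-- By Fatou's lemma it suffices to bound `cellCount`. Each cell contributes the area of a
projection, at most the area of `B` in that cell, and these areas add up. -/
lemma lintegral_hitCount_planeMeasure_le {B : Set E3} (hB : IsSigmaCompact B)
    (d : sphere (0 : E3) 1) : ∫⁻ l, hitCount B l ∂planeMeasure d ≤ surfaceMeasure B := by
  simp_rw [hitCount_eq_liminf hB.measurableSet]
  refine (lintegral_liminf_le fun m => measurable_cellCount hB m).trans ?_
  refine liminf_le_of_le (by isBoundedDefault) fun b hb => ?_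
  obtain ⟨m, hm⟩ := hb.exists
  refine hm.trans ?_
  have hc : ∀ i, MeasurableSet (hits (B ∩ cell m i)) := fun i =>
    measurableSet_hits (hB.inter_of_t2 (isSigmaCompact_cell m i))
  simp only [cellCount]
  rw [lintegral_tsum fun i => (measurable_one.indicator (hc i)).aemeasurable]
  calc ∑' i, ∫⁻ l, (hits (B ∩ cell m i)).indicator 1 l ∂planeMeasure d
      = ∑' i, planeMeasure d (hits (B ∩ cell m i)) := by
        congr 1 with i; rw [lintegral_indicator_one (hc i)]
    _ ≤ ∑' i, surfaceMeasure (B ∩ cell m i) :=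
        ENNReal.tsum_le_tsum fun i => planeMeasure_hits_le d (hc i)
    _ = surfaceMeasure B := by
        rw [← measure_iUnion, ← Set.inter_iUnion, iUnion_cell, Set.inter_univ]
        · exact fun i j hij => ((pairwise_disjoint_cell m hij).mono Set.inter_subset_right
            Set.inter_subset_right)
        · exact fun i => hB.measurableSet.inter (measurableSet_cell m i)

end Ray

/-! ### Nearly flat sets seen from a fixed direction -/

/-- A set all of whose chords make a small angle with the plane `n^⊥`. -/
def IsFlat (ε : ℝ) (n : E3) (K : Set E3) : Prop :=
  ∀ x ∈ K, ∀ y ∈ K, |⟪n, x - y⟫| ≤ ε * ‖x - y‖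

lemma IsFlat.mono {ε : ℝ} {n : E3} {A B : Set E3} (h : IsFlat ε n B) (hAB : A ⊆ B) :
    IsFlat ε n A := fun x hx y hy => h x (hAB hx) y (hAB hy)

namespace Ray

lemma inner_self_sphere (d : sphere (0 : E3) 1) : ⟪(d : E3), (d : E3)⟫ = 1 := by
  rw [real_inner_self_eq_norm_sq, norm_eq_of_mem_sphere, one_pow]

lemma through_mem_hits {d : sphere (0 : E3) 1} {x : E3} {B : Set E3} :
    through (d, x) ∈ hits B ↔ ∃ b ∈ B, ∃ t : ℝ, b = x + t • (d : E3) := by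
  constructor
  · rintro ⟨b, ⟨t, hb⟩, hB⟩
    refine ⟨b, hB, t - ⟪(d : E3), x⟫, ?_⟩
    rw [hb]
    simp only [base, through, dir]
    module
  · rintro ⟨b, hB, t, hb⟩
    refine ⟨b, ⟨t + ⟪(d : E3), x⟫, ?_⟩, hB⟩
    rw [hb]
    simp only [base, through, dir]
    module

/-- Projecting `n^⊥` along `d` scales area by `|⟪n, d⟫|`. By `planeMeasure_apply` both sides are
volumes of slabs of height one over the projected sets, so the factor is read off from the
determinant of a linear map of space that carries one slab to the other. -/
lemma planeMeasure_hits_of_subset_orthogonal {n d : sphere (0 : E3) 1}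
    (h0 : ⟪(n : E3), (d : E3)⟫ ≠ 0) {B : Set E3} (hB : IsCompact B)
    (hBn : ∀ x ∈ B, ⟪(n : E3), x⟫ = 0) :
    planeMeasure d (hits B) = ENNReal.ofReal |⟪(n : E3), (d : E3)⟫| * surfaceMeasure B := by
  have hm := (isCompact_hits hB).measurableSet
  set c := ⟪(n : E3), (d : E3)⟫ with hc
  have hdn : ⟪(d : E3), (n : E3)⟫ = c := real_inner_comm _ _
  have hnn := inner_self_sphere n
  have hdd := inner_self_sphere d
  have hn : planeMeasure n (hits B) = surfaceMeasure B := by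
    rw [planeMeasure_hits n hm]
    congr 1
    conv_rhs => rw [← Set.image_id B]
    refine Set.image_congr fun x hx => ?_
    rw [id, Submodule.starProjection_eq_self_iff]
    exact Submodule.mem_orthogonal_singleton_iff_inner_right.2 (hBn x hx)
  -- `Θ` fixes `n^⊥` and sends `n` to `c⁻¹ • d`, so lines along `n` become lines along `d` through
  -- the same points of `n^⊥`; its determinant is `1`. `Ψ` then slides along `d` until the height
  -- over `d^⊥` equals the former height over `n^⊥`; its determinant is `c`.
  let Ψ : E3 →ₗ[ℝ] E3 := LinearMap.transvection (innerSL ℝ ((n : E3) - d)).toLinearMap (d : E3)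
  let Θ : E3 →ₗ[ℝ] E3 :=
    LinearMap.transvection (innerSL ℝ (n : E3)).toLinearMap (c⁻¹ • (d : E3) - n)
  have hΨ : ∀ x, Ψ x = x + ⟪(n : E3) - d, x⟫ • (d : E3) := fun x => rfl
  have hΘ : ∀ x, Θ x = x + ⟪(n : E3), x⟫ • (c⁻¹ • (d : E3) - n) := fun x => rfl
  have hdet : LinearMap.det (Ψ ∘ₗ Θ) = c := by
    rw [LinearMap.det_comp, LinearMap.transvection.det, LinearMap.transvection.det]
    simp only [ContinuousLinearMap.coe_coe, innerSL_apply_apply, inner_sub_left, inner_sub_right,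
      inner_smul_right, hdd, hnn, ← hc]
    field_simp
    ring
  have hpre : (Ψ ∘ₗ Θ) ⁻¹' {x : E3 | ⟪(d : E3), x⟫ ∈ Set.Icc (0 : ℝ) 1 ∧ through (d, x) ∈ hits B} =
      {x : E3 | ⟪(n : E3), x⟫ ∈ Set.Icc (0 : ℝ) 1 ∧ through (n, x) ∈ hits B} := by
    ext z
    have hcomp : (Ψ ∘ₗ Θ) z = Θ z + ⟪(n : E3) - d, Θ z⟫ • (d : E3) := rfl
    have h1 : ⟪(d : E3), (Ψ ∘ₗ Θ) z⟫ = ⟪(n : E3), z⟫ := by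
      rw [hcomp, hΘ]
      simp only [inner_add_right, inner_smul_right, inner_sub_left, inner_sub_right, hdd, hnn,
        ← hc, hdn]
      field_simp
      ring
    have h2 : through (d, (Ψ ∘ₗ Θ) z) ∈ hits B ↔ through (n, z) ∈ hits B := by
      rw [through_mem_hits, through_mem_hits]
      refine exists_congr fun b => and_congr_right fun hb => ?_
      have hnb := hBn b hb
      rw [hcomp, hΘ]
      constructor
      · rintro ⟨t, ht⟩
        refine ⟨-⟪(n : E3), z⟫, ?_⟩
        obtain ⟨t', ht'⟩ : ∃ t' : ℝ, b = z - ⟪(n : E3), z⟫ • (n : E3) + t' • (d : E3) :=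
          ⟨⟪(n : E3), z⟫ * c⁻¹ +
            ⟪(n : E3) - d, z + ⟪(n : E3), z⟫ • (c⁻¹ • (d : E3) - n)⟫ + t, ht.trans (by module)⟩
        have : t' * c = 0 := by
          rw [ht'] at hnb
          simpa [inner_add_right, inner_smul_right, inner_sub_right, hnn, ← hc] using hnb
        have : t' = 0 := by simpa [h0] using this
        rw [ht', this]
        module
      · rintro ⟨t, ht⟩
        have : t = -⟪(n : E3), z⟫ := by
          rw [ht] at hnb
          simp only [inner_add_right, inner_smul_right, hnn] at hnb
          linarith
        refine ⟨_, ht.trans (?_ : _ = _ + (-⟪(n : E3), z⟫ * c⁻¹ -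
          ⟪(n : E3) - d, z + ⟪(n : E3), z⟫ • (c⁻¹ • (d : E3) - n)⟫) • (d : E3))⟩
        rw [this]
        module
    simp only [Set.mem_preimage, Set.mem_ofPred_eq, h1, h2]
  have hv := Measure.addHaar_preimage_linearMap (volume : Measure E3) (f := Ψ ∘ₗ Θ)
    (by rw [hdet]; exact h0)
    {x : E3 | ⟪(d : E3), x⟫ ∈ Set.Icc (0 : ℝ) 1 ∧ through (d, x) ∈ hits B}
  rw [hpre, ← planeMeasure_apply n hm, ← planeMeasure_apply d hm, hdet, hn] at hv
  rw [hv, ← mul_assoc, ← ENNReal.ofReal_mul (abs_nonneg _), abs_inv,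
    mul_inv_cancel₀ (abs_ne_zero.2 h0)]
  simp

/-- Two points of `K` on one line of direction `d` would span a chord with slope `|⟪n, d⟫| > ε`
against `n^⊥`, contrary to flatness; so the count is `0` or `1`. -/
lemma lintegral_hitCount_eq_of_isFlat {n d : sphere (0 : E3) 1} {ε : ℝ} {K : Set E3}
    (hK : IsCompact K) (hflat : IsFlat ε n K) (hε : ε < |⟪(n : E3), (d : E3)⟫|) :
    ∫⁻ l, hitCount K l ∂planeMeasure d = planeMeasure d (hits K) := by
  have hm := (isCompact_hits hK).measurableSet
  rw [← lintegral_indicator_one hm, planeMeasure,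
    lintegral_map (measurable_hitCount hK.isSigmaCompact) (measurable_ofPlane d),
    lintegral_map (measurable_one.indicator hm) (measurable_ofPlane d)]
  refine lintegral_congr fun p => ?_
  have hsub : ((ofPlane d p).points ∩ K).Subsingleton := by
    rintro x ⟨⟨t, hx⟩, hxK⟩ y ⟨⟨t', hy⟩, hyK⟩
    have hxy : x - y = (t - t') • (d : E3) := by
      rw [hx, hy]; simp only [dir, ofPlane]; module
    have h := hflat x hxK y hyK
    rw [hxy, inner_smul_right, norm_smul, norm_eq_of_mem_sphere, mul_one, abs_mul,
      Real.norm_eq_abs] at h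
    have h0 : |t - t'| = 0 := by
      by_contra hne
      have hpos : 0 < |t - t'| := lt_of_le_of_ne (abs_nonneg _) (Ne.symm hne)
      nlinarith
    rw [abs_eq_zero] at h0
    rw [h0, zero_smul] at hxy
    exact sub_eq_zero.1 hxy
  by_cases h : ofPlane d p ∈ hits K
  · rw [Set.indicator_of_mem h, Pi.one_apply, hitCount]
    obtain ⟨x, hx⟩ := h
    rw [hsub.eq_singleton_of_mem hx]
    simp
  · rw [Set.indicator_of_notMem h, hitCount, Set.not_nonempty_iff_eq_empty.1 h]
    simp

/-- Sliding `K` along `d` into the plane `n^⊥` does not change which lines of direction `d` meet it.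
By flatness the slide `g` differs from the identity by an `η`-Lipschitz map, so it changes areas at
most by the factors `(1 ± η) ^ 2`, and the planar case applies to `g '' K`. -/
lemma planeMeasure_hits_of_isFlat {n d : sphere (0 : E3) 1} {ε η : ℝ} (hη0 : 0 ≤ η) (hη : η < 1)
    {K : Set E3} (hK : IsCompact K) (hflat : IsFlat ε n K)
    (h0 : ⟪(n : E3), (d : E3)⟫ ≠ 0) (hε : ε ≤ η * |⟪(n : E3), (d : E3)⟫|) :
    planeMeasure d (hits K) ≤
      ENNReal.ofReal ((1 + η) ^ 2 * |⟪(n : E3), (d : E3)⟫|) * surfaceMeasure K ∧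
    ENNReal.ofReal ((1 - η) ^ 2 * |⟪(n : E3), (d : E3)⟫|) * surfaceMeasure K ≤
      planeMeasure d (hits K) := by
  set c := ⟪(n : E3), (d : E3)⟫ with hc
  have hcpos : 0 < |c| := abs_pos.2 h0
  let g : E3 → E3 := fun x => x - (⟪(n : E3), x⟫ / c) • (d : E3)
  have hg : Continuous g := by fun_prop
  have hgK : IsCompact (g '' K) := hK.image hg
  have hdiff : ∀ x ∈ K, ∀ y ∈ K, ‖(g x - g y) - (x - y)‖ ≤ η * ‖x - y‖ := by
    intro x hx y hy
    have : (g x - g y) - (x - y) = (-(⟪(n : E3), x - y⟫ / c)) • (d : E3) := by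
      simp only [g, inner_sub_right]; module
    rw [this, norm_smul, norm_eq_of_mem_sphere, mul_one, norm_neg, Real.norm_eq_abs, abs_div,
      div_le_iff₀ hcpos]
    calc _ ≤ _ := hflat x hx y hy
      _ ≤ η * |c| * ‖x - y‖ := by gcongr
      _ = _ := by ring
  have hplane : planeMeasure d (hits K) = ENNReal.ofReal |c| * surfaceMeasure (g '' K) := by
    rw [← planeMeasure_hits_of_subset_orthogonal h0 hgK,
      planeMeasure_hits d (isCompact_hits hK).measurableSet,
      planeMeasure_hits d (isCompact_hits hgK).measurableSet, Set.image_image]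
    · congr 1
      refine Set.image_congr fun x _ => ?_
      have hd0 : (ℝ ∙ (d : E3))ᗮ.starProjection (d : E3) = 0 := by
        rw [Submodule.starProjection_apply_eq_zero_iff]
        exact Submodule.le_orthogonal_orthogonal _ (Submodule.mem_span_singleton_self _)
      simp only [g, map_sub, map_smul, hd0, smul_zero, sub_zero]
    · rintro _ ⟨x, -, rfl⟩
      simp only [g, inner_sub_right, inner_smul_right, ← hc]
      field_simp
      ring
  rw [hplane]
  constructor
  · have hL : LipschitzOnWith (Real.toNNReal (1 + η)) g K := by
      refine LipschitzOnWith.of_dist_le_mul fun x hx y hy => ?_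
      rw [Real.coe_toNNReal _ (by linarith), dist_eq_norm, dist_eq_norm]
      have h1 := hdiff x hx y hy
      have h2 := norm_add_le ((g x - g y) - (x - y)) (x - y)
      rw [sub_add_cancel] at h2
      linarith
    calc _ ≤ ENNReal.ofReal |c| * (ENNReal.ofReal (1 + η) ^ 2 * surfaceMeasure K) := by
          gcongr; exact surfaceMeasure_image_le hL
      _ = _ := by
        rw [mul_comm ((1 + η) ^ 2), ENNReal.ofReal_mul (abs_nonneg _),
          ENNReal.ofReal_pow (by linarith), mul_assoc]
  · have hη1 : 0 < 1 - η := by linarith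
    have hanti : ∀ x ∈ K, ∀ y ∈ K, (1 - η) * ‖x - y‖ ≤ ‖g x - g y‖ := by
      intro x hx y hy
      have h1 := hdiff x hx y hy
      have h2 := norm_sub_norm_le (x - y) ((x - y) - (g x - g y))
      rw [sub_sub_cancel, norm_sub_rev (x - y)] at h2
      linarith
    have hinj : Set.InjOn g K := by
      intro x hx y hy hxy
      have h1 := hanti x hx y hy
      rw [hxy, sub_self, norm_zero] at h1
      have : ‖x - y‖ ≤ 0 := by by_contra hne; nlinarith
      exact sub_eq_zero.1 (norm_le_zero_iff.1 this)
    have hL : LipschitzOnWith (Real.toNNReal (1 - η)⁻¹) (Function.invFunOn g K) (g '' K) := by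
      refine LipschitzOnWith.of_dist_le_mul ?_
      rintro _ ⟨x, hx, rfl⟩ _ ⟨y, hy, rfl⟩
      rw [hinj.leftInvOn_invFunOn hx, hinj.leftInvOn_invFunOn hy,
        Real.coe_toNNReal _ (by positivity), dist_eq_norm, dist_eq_norm,
        inv_mul_eq_div, le_div_iff₀ hη1, mul_comm]
      exact hanti x hx y hy
    have himg : Function.invFunOn g K '' (g '' K) = K := hinj.leftInvOn_invFunOn.image_image
    have h := surfaceMeasure_image_le hL
    rw [himg] at h
    calc ENNReal.ofReal ((1 - η) ^ 2 * |c|) * surfaceMeasure K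
        ≤ ENNReal.ofReal ((1 - η) ^ 2 * |c|) *
          (ENNReal.ofReal (1 - η)⁻¹ ^ 2 * surfaceMeasure (g '' K)) := by gcongr; exact h
      _ = _ := by
        rw [← mul_assoc, ← ENNReal.ofReal_pow (by positivity), ← ENNReal.ofReal_mul (by positivity)]
        congr 2
        field_simp

end Ray

/-! ### Symmetry of the sphere and the Crofton constant -/

/-- A linear isometry acts on the unit sphere. -/
def sphereMap (R : E3 ≃ₗᵢ[ℝ] E3) (d : sphere (0 : E3) 1) : sphere (0 : E3) 1 :=
  ⟨R d, by simp⟩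

lemma continuous_sphereMap (R : E3 ≃ₗᵢ[ℝ] E3) : Continuous (sphereMap R) := by
  unfold sphereMap; fun_prop

-- The measure on the sphere is, up to a factor, the volume of the cone over a set, and isometries
-- carry cones to cones.
open scoped Pointwise in
lemma measurePreserving_sphereMap (R : E3 ≃ₗᵢ[ℝ] E3) :
    MeasurePreserving (sphereMap R) (volume : Measure E3).toSphere
      (volume : Measure E3).toSphere := by
  refine ⟨(continuous_sphereMap R).measurable, Measure.ext fun s hs => ?_⟩
  have hpre := (continuous_sphereMap R).measurable hs
  rw [Measure.map_apply (continuous_sphereMap R).measurable hs, Measure.toSphere_apply' _ hpre,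
    Measure.toSphere_apply' _ hs]
  congr 1
  have : Set.Ioo (0 : ℝ) 1 • ((↑) '' (sphereMap R ⁻¹' s) : Set E3) =
      R ⁻¹' (Set.Ioo (0 : ℝ) 1 • ((↑) '' s : Set E3)) := by
    ext x
    simp only [Set.mem_smul, Set.mem_image, Set.mem_preimage]
    constructor
    · rintro ⟨t, ht, _, ⟨d, hd, rfl⟩, rfl⟩
      exact ⟨t, ht, _, ⟨sphereMap R d, hd, rfl⟩, by simp [sphereMap]⟩
    · rintro ⟨t, ht, _, ⟨d, hd, rfl⟩, h⟩
      refine ⟨t, ht, _, ⟨sphereMap R.symm d, ?_, rfl⟩, ?_⟩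
      · have : sphereMap R (sphereMap R.symm d) = d := by
          apply Subtype.ext; simp [sphereMap]
        rwa [this]
      · apply R.injective
        simp [sphereMap, h]
  rw [this]
  exact R.measurePreserving.measure_preimage_equiv (f := R.toHomeomorph.toMeasurableEquiv) _

lemma lintegral_sphere_inner (n n' : sphere (0 : E3) 1) {h : ℝ → ℝ≥0∞} (hh : Measurable h) :
    ∫⁻ d, h ⟪(n : E3), (d : E3)⟫ ∂(volume : Measure E3).toSphere =
      ∫⁻ d, h ⟪(n' : E3), (d : E3)⟫ ∂(volume : Measure E3).toSphere := by
  -- The reflection in the hyperplane orthogonal to `n - n'` exchanges `n` and `n'`.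
  let R : E3 ≃ₗᵢ[ℝ] E3 := (ℝ ∙ ((n : E3) - n'))ᗮ.reflection
  have hR : R n = n' := Submodule.reflection_sub (by simp)
  have hm : Measurable fun d : sphere (0 : E3) 1 => h ⟪(n' : E3), (d : E3)⟫ :=
    hh.comp (Continuous.measurable (by fun_prop))
  rw [← (measurePreserving_sphereMap R).lintegral_comp hm]
  refine lintegral_congr fun d => ?_
  rw [← hR, sphereMap]
  simp

/-- A fixed point of the unit sphere. -/
def pole : sphere (0 : E3) 1 := ⟨EuclideanSpace.single 0 1, by simp⟩

/-- The constant of the Cauchy–Crofton formula. -/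
def croftonConst : ℝ≥0∞ :=
  ∫⁻ d, ENNReal.ofReal |⟪(pole : E3), (d : E3)⟫| ∂(volume : Measure E3).toSphere

/-- The band of directions that are nearly orthogonal to `n`. -/
def band (n : sphere (0 : E3) 1) (η : ℝ) : Set (sphere (0 : E3) 1) :=
  {d | |⟪(n : E3), (d : E3)⟫| < η}

/-- The measure of a band around the equator of the unit sphere. -/
def equatorBand (η : ℝ) : ℝ≥0∞ :=
  (volume : Measure E3).toSphere (band pole η)

lemma lintegral_abs_inner_sphere (n : sphere (0 : E3) 1) :
    ∫⁻ d, ENNReal.ofReal |⟪(n : E3), (d : E3)⟫| ∂(volume : Measure E3).toSphere = croftonConst :=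
  lintegral_sphere_inner n pole (h := fun t => ENNReal.ofReal |t|) (by fun_prop)

lemma measurableSet_band (n : sphere (0 : E3) 1) (η : ℝ) :
    MeasurableSet (band n η) :=
  (isOpen_lt (by fun_prop) continuous_const).measurableSet

lemma measure_band (n : sphere (0 : E3) 1) (η : ℝ) :
    (volume : Measure E3).toSphere (band n η) = equatorBand η := by
  have h := lintegral_sphere_inner n pole (h := {t | |t| < η}.indicator 1)
    (measurable_one.indicator (isOpen_lt (by fun_prop) continuous_const).measurableSet)
  rw [equatorBand, ← lintegral_indicator_one (measurableSet_band n η),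
    ← lintegral_indicator_one (measurableSet_band pole η)]
  exact h

lemma croftonConst_ne_top : croftonConst ≠ ∞ := by
  refine ne_top_of_le_ne_top (measure_ne_top (volume : Measure E3).toSphere Set.univ) ?_
  rw [← lintegral_one]
  refine lintegral_mono fun d => ?_
  rw [ENNReal.ofReal_le_one]
  have := abs_real_inner_le_norm (pole : E3) (d : E3)
  simpa using this

lemma croftonConst_ne_zero : croftonConst ≠ 0 := by
  have hc : Continuous fun d : sphere (0 : E3) 1 => ENNReal.ofReal |⟪(pole : E3), (d : E3)⟫| :=
    ENNReal.continuous_ofReal.comp (by fun_prop)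
  rw [croftonConst, ← pos_iff_ne_zero, lintegral_pos_iff_support hc.measurable]
  refine hc.isOpen_support.measure_pos _ ⟨pole, ?_⟩
  simp

/-- The cone over the equator lies in a plane, which has no volume. -/
lemma toSphere_equator :
    (volume : Measure E3).toSphere {d | ⟪(pole : E3), (d : E3)⟫ = 0} = 0 := by
  rw [Measure.toSphere_apply' _ (isClosed_eq (by fun_prop) continuous_const).measurableSet]
  refine mul_eq_zero_of_right _ (measure_mono_null (t := ((ℝ ∙ (pole : E3))ᗮ : Set E3)) ?_ ?_)
  · rintro _ ⟨t, -, _, ⟨d, hd, rfl⟩, rfl⟩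
    rw [SetLike.mem_coe, Submodule.mem_orthogonal_singleton_iff_inner_right]
    simp only [inner_smul_right]
    rw [show ⟪(pole : E3), (d : E3)⟫ = 0 from hd, mul_zero]
  · refine Measure.addHaar_submodule _ _ fun h => ?_
    have : (pole : E3) ∈ (ℝ ∙ (pole : E3))ᗮ := by rw [h]; trivial
    rw [Submodule.mem_orthogonal_singleton_iff_inner_right, Ray.inner_self_sphere] at this
    exact one_ne_zero this

lemma tendsto_equatorBand : Tendsto equatorBand (𝓝[>] 0) (𝓝 0) := by
  have h := tendsto_measure_biInter_gt (μ := (volume : Measure E3).toSphere) (a := (0 : ℝ))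
    (s := fun η => {d : sphere (0 : E3) 1 | |⟪(pole : E3), (d : E3)⟫| < η})
    (fun η _ => (measurableSet_band pole η).nullMeasurableSet)
    (fun i j _ hij d hd => lt_of_lt_of_le hd hij) ⟨1, one_pos, measure_ne_top _ _⟩
  have h0 : (⋂ η > (0 : ℝ), {d : sphere (0 : E3) 1 | |⟪(pole : E3), (d : E3)⟫| < η}) =
      {d : sphere (0 : E3) 1 | ⟪(pole : E3), (d : E3)⟫ = 0} := by
    ext d
    simp only [Set.mem_iInter, Set.mem_ofPred_eq]
    constructor
    · intro H
      by_contra hne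
      exact lt_irrefl _ (H _ (abs_pos.2 hne))
    · intro H η hη
      simpa [H] using hη
  rw [h0, toSphere_equator] at h
  exact h

/-! ### Crofton estimates for nearly flat pieces -/

namespace Ray

lemma lintegral_measure {f : Ray → ℝ≥0∞} (hf : Measurable f) :
    ∫⁻ l, f l ∂(Ray.measure) =
      ∫⁻ d, ∫⁻ l, f l ∂planeMeasure d ∂(volume : Measure E3).toSphere :=
  Measure.lintegral_bind measurable_planeMeasure.aemeasurable hf.aemeasurable

lemma lintegral_hitCount_le {B : Set E3} (hB : IsSigmaCompact B) :
    ∫⁻ l, hitCount B l ∂(Ray.measure) ≤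
      surfaceMeasure B * (volume : Measure E3).toSphere Set.univ := by
  rw [lintegral_measure (measurable_hitCount hB), ← lintegral_const]
  exact lintegral_mono fun d => lintegral_hitCount_planeMeasure_le hB d

section Flat

variable {n : sphere (0 : E3) 1} {η : ℝ} {K : Set E3}

/-- Flatness `η ^ 2` is matched to a band of width `η`: outside the band `η ^ 2 ≤ η * |⟪n, d⟫|`, as
the estimate for a single direction requires. Inside the band the bound by area is used. -/
lemma lintegral_hitCount_le_of_isFlat (hη0 : 0 < η) (hη : η < 1) (hK : IsCompact K)
    (hflat : IsFlat (η ^ 2) n K) :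
    ∫⁻ l, hitCount K l ∂(Ray.measure) ≤
      (ENNReal.ofReal ((1 + η) ^ 2) * croftonConst + equatorBand η) * surfaceMeasure K := by
  have hm1 : Measurable fun d : sphere (0 : E3) 1 =>
      ENNReal.ofReal ((1 + η) ^ 2) * ENNReal.ofReal |⟪(n : E3), (d : E3)⟫| :=
    Measurable.const_mul (ENNReal.continuous_ofReal.comp (by fun_prop)).measurable _
  have hm2 : Measurable fun d : sphere (0 : E3) 1 =>
      ENNReal.ofReal ((1 + η) ^ 2) * ENNReal.ofReal |⟪(n : E3), (d : E3)⟫| +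
        (band n η).indicator 1 d := hm1.add (measurable_one.indicator (measurableSet_band n η))
  rw [lintegral_measure (measurable_hitCount hK.isSigmaCompact),
    ← lintegral_abs_inner_sphere n, ← measure_band n,
    ← lintegral_indicator_one (measurableSet_band n η), ← lintegral_const_mul' _ _ (by simp),
    ← lintegral_add_left hm1,
    ← lintegral_mul_const _ hm2]
  refine lintegral_mono fun d => ?_
  by_cases hd : d ∈ band n η
  · rw [Set.indicator_of_mem hd, Pi.one_apply, add_mul, one_mul]
    exact (lintegral_hitCount_planeMeasure_le hK.isSigmaCompact d).trans le_add_self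
  · rw [Set.indicator_of_notMem hd, add_zero,
      ← ENNReal.ofReal_mul (by positivity)]
    have hd' : η ≤ |⟪(n : E3), (d : E3)⟫| := not_lt.1 hd
    rw [lintegral_hitCount_eq_of_isFlat hK hflat (by nlinarith)]
    exact (planeMeasure_hits_of_isFlat hη0.le hη hK hflat (abs_pos.1 (hη0.trans_le hd'))
      (by nlinarith)).1

lemma le_lintegral_hitCount_of_isFlat (hη0 : 0 < η) (hη : η < 1) (hK : IsCompact K)
    (hflat : IsFlat (η ^ 2) n K) :
    ENNReal.ofReal ((1 - η) ^ 2) * croftonConst * surfaceMeasure K ≤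
      ∫⁻ l, hitCount K l ∂(Ray.measure) + equatorBand η * surfaceMeasure K := by
  have hm1 : Measurable fun d : sphere (0 : E3) 1 =>
      ENNReal.ofReal ((1 - η) ^ 2) * ENNReal.ofReal |⟪(n : E3), (d : E3)⟫| :=
    Measurable.const_mul (ENNReal.continuous_ofReal.comp (by fun_prop)).measurable _
  rw [lintegral_measure (measurable_hitCount hK.isSigmaCompact),
    ← lintegral_abs_inner_sphere n, ← measure_band n,
    ← lintegral_indicator_one (measurableSet_band n η), ← lintegral_const_mul' _ _ (by simp),
    ← lintegral_mul_const _ hm1,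
    ← lintegral_mul_const _ (measurable_one.indicator (measurableSet_band n η)),
    ← lintegral_add_right _ ((measurable_one.indicator (measurableSet_band n η)).mul_const _)]
  refine lintegral_mono fun d => ?_
  rw [← ENNReal.ofReal_mul (by positivity)]
  have hs : |⟪(n : E3), (d : E3)⟫| ≤ 1 := by
    simpa using abs_real_inner_le_norm (n : E3) (d : E3)
  by_cases hd : d ∈ band n η
  · rw [Set.indicator_of_mem hd, Pi.one_apply]
    -- In the band the added error term suffices, because `(1 - η) ^ 2 * |⟪n, d⟫| ≤ 1`.
    refine le_add_self.trans' ?_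
    gcongr
    rw [ENNReal.ofReal_le_one]
    have hd' : |⟪(n : E3), (d : E3)⟫| < η := hd
    have := abs_nonneg ⟪(n : E3), (d : E3)⟫
    nlinarith
  · rw [Set.indicator_of_notMem hd, zero_mul, add_zero]
    have hd' : η ≤ |⟪(n : E3), (d : E3)⟫| := not_lt.1 hd
    rw [lintegral_hitCount_eq_of_isFlat hK hflat (by nlinarith)]
    exact (planeMeasure_hits_of_isFlat hη0.le hη hK hflat (abs_pos.1 (hη0.trans_le hd'))
      (by nlinarith)).2

end Flat

end Ray

/-! ### Rays meeting a set of zero area -/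

namespace Ray

/-- The projection of `F` lies in a disc of radius `diam F`. The constant is `π`, in the form in
which it occurs in the formula for volumes of balls. -/
lemma planeMeasure_hits_le_ediam (d : sphere (0 : E3) 1) {F : Set E3} (hF : IsCompact F) :
    planeMeasure d (hits F) ≤ ediam F ^ 2 *
      ENNReal.ofReal (√Real.pi ^ 2 / Real.Gamma ((2 : ℕ) / 2 + 1)) := by
  rw [planeMeasure, Measure.map_apply (measurable_ofPlane d) (isCompact_hits hF).measurableSet,
    ofPlane_preimage_hits]
  rcases F.eq_empty_or_nonempty with rfl | ⟨x, hx⟩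
  · simp
  have hrank := finrank_orthogonal d
  have : Nontrivial (ℝ ∙ (d : E3))ᗮ := Module.nontrivial_of_finrank_pos (R := ℝ) (by omega)
  have hball := InnerProductSpace.volume_closedBall
    ((ℝ ∙ (d : E3))ᗮ.orthogonalProjectionOnto x) (diam F)
  rw [hrank] at hball
  have hd : ENNReal.ofReal (diam F) = ediam F :=
    ENNReal.ofReal_toReal hF.isBounded.ediam_ne_top
  rw [← hd, ← hball]
  refine measure_mono ?_
  rintro _ ⟨y, hy, rfl⟩
  rw [mem_closedBall, dist_eq_norm, ← map_sub]
  refine (Submodule.norm_orthogonalProjectionOnto_apply_le _ _).trans ?_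
  rw [← dist_eq_norm]
  exact dist_le_diam_of_mem hF.isBounded hy hx

lemma measure_hits_le_ediam {F : Set E3} (hF : IsCompact F) :
    Ray.measure (hits F) ≤ ediam F ^ 2 *
      (ENNReal.ofReal (√Real.pi ^ 2 / Real.Gamma ((2 : ℕ) / 2 + 1)) *
        (volume : Measure E3).toSphere Set.univ) := by
  rw [Ray.measure, Measure.bind_apply (isCompact_hits hF).measurableSet
    measurable_planeMeasure.aemeasurable, ← mul_assoc, ← lintegral_const]
  exact lintegral_mono fun d => planeMeasure_hits_le_ediam d hF

/-- A null set has countable covers with arbitrarily small sum of squared diameters, and this sum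
bounds the measure of the rays that meet the cover. Only outer measure is used, so `hits Z` need not
be measurable. -/
lemma measure_hits_of_null {Z : Set E3} (hZ : surfaceMeasure Z = 0) :
    Ray.measure (hits Z) = 0 := by
  have hZ' : Measure.hausdorffMeasure (2 : ℝ) Z = 0 := by
    rw [surfaceMeasure, Measure.euclideanHausdorffMeasure_def, Measure.smul_apply,
      ENNReal.smul_def, smul_eq_mul, mul_eq_zero] at hZ
    have h0 := Measure.addHaarScalarFactor_volume_hausdorffMeasure_ne_zero 2
    simpa using hZ.resolve_left (by simpa using h0)
  set C := ENNReal.ofReal (√Real.pi ^ 2 / Real.Gamma ((2 : ℕ) / 2 + 1)) *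
        (volume : Measure E3).toSphere Set.univ with hC
  have hCtop : C ≠ ∞ := ENNReal.mul_ne_top (by simp) (measure_ne_top _ _)
  have key : ∀ ε : ℝ≥0∞, 0 < ε → Ray.measure (hits Z) ≤ ε * C := by
    intro ε hε
    rw [Measure.hausdorffMeasure_apply] at hZ'
    -- The bound `1` on the diameters serves only to make the closures of the covering sets compact.
    have h1 := le_iSup₂ (f := fun (r : ℝ≥0∞) (_ : 0 < r) =>
      ⨅ (t : ℕ → Set E3) (_ : Z ⊆ ⋃ n, t n) (_ : ∀ n, ediam (t n) ≤ r),
          ∑' n, ⨆ _ : (t n).Nonempty, ediam (t n) ^ (2 : ℝ)) 1 one_pos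
    rw [hZ'] at h1
    have h2 := lt_of_le_of_lt h1 hε
    simp only [iInf_lt_iff] at h2
    obtain ⟨t, hZt, ht, hsum⟩ := h2
    have hcomp : ∀ n, IsCompact (closure (t n)) := fun n =>
      (isBounded_iff_ediam_ne_top.2
        (ne_top_of_le_ne_top ENNReal.one_ne_top (ht n))).isCompact_closure
    calc Ray.measure (hits Z) ≤ Ray.measure (⋃ n, hits (closure (t n))) := by
          refine measure_mono ?_
          rw [← hits_iUnion]
          exact hits_mono (hZt.trans (Set.iUnion_mono fun n => subset_closure))
      _ ≤ ∑' n, Ray.measure (hits (closure (t n))) := measure_iUnion_le _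
      _ ≤ ∑' n, (⨆ _ : (t n).Nonempty, ediam (t n) ^ (2 : ℝ)) * C := by
          refine ENNReal.tsum_le_tsum fun n => (measure_hits_le_ediam (hcomp n)).trans ?_
          rw [ediam_closure]
          gcongr
          rcases (t n).eq_empty_or_nonempty with h | h
          · simp [h]
          · simp [h]
      _ = (∑' n, ⨆ _ : (t n).Nonempty, ediam (t n) ^ (2 : ℝ)) * C := ENNReal.tsum_mul_right
      _ ≤ ε * C := by gcongr
  refine le_antisymm (ENNReal.le_of_forall_pos_le_add fun δ hδ _ => ?_) zero_le
  rw [zero_add]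
  refine (key (δ / (C + 1)) (ENNReal.div_pos (by simpa using hδ.ne') (by finiteness))).trans ?_
  rw [ENNReal.div_eq_inv_mul, mul_comm _ (δ : ℝ≥0∞), mul_assoc]
  calc (δ : ℝ≥0∞) * ((C + 1)⁻¹ * C) ≤ δ * ((C + 1)⁻¹ * (C + 1)) := by gcongr; exact le_self_add
    _ = δ := by rw [ENNReal.inv_mul_cancel (by simp) (by finiteness), mul_one]

end Ray

/-! ### Covering a surface by nearly flat compact sets -/

lemma exists_normal (A : EuclideanSpace ℝ (Fin 2) →L[ℝ] E3) :
    ∃ n : sphere (0 : E3) 1, ∀ w, ⟪(n : E3), A w⟫ = 0 := by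
  have hne : A.range ≠ ⊤ := by
    intro h
    have h1 := LinearMap.finrank_range_le (A : EuclideanSpace ℝ (Fin 2) →ₗ[ℝ] E3)
    have h2 : Module.finrank ℝ A.range = 3 := by rw [h, finrank_top]; simp
    have h3 : Module.finrank ℝ (EuclideanSpace ℝ (Fin 2)) = 2 := by simp
    rw [h3] at h1
    have : Module.finrank ℝ A.range ≤ 2 := h1
    omega
  have hbot : A.rangeᗮ ≠ ⊥ := fun h => hne (Submodule.orthogonal_eq_bot_iff.1 h)
  obtain ⟨v, hv, hv0⟩ := Submodule.exists_mem_ne_zero_of_ne_bot hbot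
  refine ⟨⟨(‖v‖⁻¹ : ℝ) • v, by simp [norm_smul, hv0]⟩, fun w => ?_⟩
  have := (Submodule.mem_orthogonal' _ _).1 hv (A w) ⟨w, rfl⟩
  simp [inner_smul_left, this]

/-- By strict differentiability `φ x - φ y` is within `c * ‖x - y‖` of `A (x - y)`, which is
orthogonal to `n`. Injectivity of `A` bounds `‖x - y‖` by a multiple of `‖φ x - φ y‖`, which turns
this into a bound on the slope of chords. -/
lemma exists_compact_nhds_isFlat_image {φ : EuclideanSpace ℝ (Fin 2) → E3}
    {U : Set (EuclideanSpace ℝ (Fin 2))} (hU : IsOpen U) (hφ : ContDiffOn ℝ 1 φ U)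
    {u : EuclideanSpace ℝ (Fin 2)} (hu : u ∈ U) (hinj : Function.Injective (fderiv ℝ φ u))
    {ε : ℝ} (hε : 0 < ε) :
    ∃ V ∈ 𝓝 u, IsCompact (φ '' V) ∧ ∃ n : sphere (0 : E3) 1, IsFlat ε n (φ '' V) := by
  set A := fderiv ℝ φ u with hA
  have hat : ContDiffAt ℝ 1 φ u := hφ.contDiffAt (hU.mem_nhds hu)
  have hstrict : HasStrictFDerivAt φ A u := hat.hasStrictFDerivAt one_ne_zero
  obtain ⟨k, hk, hanti⟩ := LinearMap.exists_antilipschitzWith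
    (A : EuclideanSpace ℝ (Fin 2) →ₗ[ℝ] E3) (LinearMap.ker_eq_bot.2 hinj)
  obtain ⟨n, hn⟩ := exists_normal A
  have hk' : (0 : ℝ) < k := by exact_mod_cast hk
  -- Since `‖φ x - φ y‖ ≥ (1 / k - c) * ‖x - y‖`, flatness `ε` requires `c ≤ ε * (1 / k - c)`; this
  -- is the case of equality.
  let c : NNReal := Real.toNNReal (ε / (k * (1 + ε)))
  have hc : (c : ℝ) = ε / (k * (1 + ε)) := Real.coe_toNNReal _ (by positivity)
  have hcpos : 0 < c := Real.toNNReal_pos.2 (by positivity)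
  obtain ⟨s, hs, happ⟩ := hstrict.approximates_deriv_on_nhds (c := c) (Or.inr hcpos)
  obtain ⟨r, hr, hball⟩ := nhds_basis_closedBall.mem_iff.1 (inter_mem hs (hU.mem_nhds hu))
  refine ⟨closedBall u r, closedBall_mem_nhds u hr,
    (isCompact_closedBall u r).image_of_continuousOn
      (hφ.continuousOn.mono fun x hx => (hball hx).2), n, ?_⟩
  rintro _ ⟨x, hx, rfl⟩ _ ⟨y, hy, rfl⟩
  have h1 := happ x (hball hx).1 y (hball hy).1
  have h2 : ‖x - y‖ ≤ k * ‖A (x - y)‖ := by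
    have := hanti.le_mul_dist x y
    rw [dist_eq_norm, dist_eq_norm, ← map_sub] at this
    exact this
  have h3 : |⟪(n : E3), φ x - φ y⟫| ≤ c * ‖x - y‖ := by
    have : ⟪(n : E3), φ x - φ y⟫ = ⟪(n : E3), φ x - φ y - A (x - y)⟫ := by
      rw [inner_sub_right _ (φ x - φ y), hn, sub_zero]
    rw [this]
    refine (abs_real_inner_le_norm _ _).trans ?_
    rwa [norm_eq_of_mem_sphere, one_mul]
  have h4 : ‖A (x - y)‖ ≤ ‖φ x - φ y‖ + c * ‖x - y‖ := by
    have := norm_sub_norm_le (A (x - y)) (φ x - φ y)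
    rw [norm_sub_rev (A (x - y))] at this
    linarith
  refine h3.trans ?_
  have h5 : c * (k * (1 + ε)) = ε := by rw [hc]; field_simp
  have h7 : c * (1 + ε) * (k * ‖x - y‖) ≤ ε * (k * (‖φ x - φ y‖ + c * ‖x - y‖)) := by
    have : c * (1 + ε) * (k * ‖x - y‖) = ε * ‖x - y‖ := by linear_combination ‖x - y‖ * h5
    rw [this]
    gcongr
    exact h2.trans (by gcongr)
  have h8 : k * (c * ‖x - y‖) ≤ k * (ε * ‖φ x - φ y‖) := by nlinarith
  exact le_of_mul_le_mul_left h8 hk'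

lemma IsSurface.exists_flat_cover {S : Set E3} (hS : IsSurface S) {ε : ℝ} (hε : 0 < ε) :
    ∃ K : ℕ → Set E3, (∀ k, IsCompact (K k) ∧ ∃ n : sphere (0 : E3) 1, IsFlat ε n (K k)) ∧
      surfaceMeasure (S \ ⋃ k, K k) = 0 := by
  obtain ⟨U, φ, hUφ, hnull⟩ := hS.exists_patches
  have hex : ∀ m, ∀ u : EuclideanSpace ℝ (Fin 2), ∃ V : Set (EuclideanSpace ℝ (Fin 2)), u ∈ U m →
      V ∈ 𝓝 u ∧ IsCompact (φ m '' V) ∧ ∃ n : sphere (0 : E3) 1, IsFlat ε n (φ m '' V) := by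
    intro m u
    by_cases hu : u ∈ U m
    · obtain ⟨V, hV⟩ := exists_compact_nhds_isFlat_image (hUφ m).1 (hUφ m).2.1 hu
        ((hUφ m).2.2 u hu) hε
      exact ⟨V, fun _ => hV⟩
    · exact ⟨∅, fun h => absurd h hu⟩
  choose V hV using hex
  have hcount : ∀ m, ∃ t ⊆ U m, t.Countable ∧ U m ⊆ ⋃ x ∈ t, V m x := fun m =>
    TopologicalSpace.countable_cover_nhdsWithin fun x hx => mem_nhdsWithin_of_mem_nhds (hV m x hx).1
  choose t htU htc hUt using hcount
  -- The empty set is inserted so that the countable family is nonempty and can be enumerated by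
  -- `ℕ`.
  let T : Set (Set E3) := insert ∅ (⋃ m, (fun x => φ m '' V m x) '' t m)
  have hTc : T.Countable := (Set.countable_iUnion fun m => (htc m).image _).insert _
  obtain ⟨K, hK⟩ := hTc.exists_eq_range ⟨∅, Set.mem_insert _ _⟩
  refine ⟨K, fun k => ?_, measure_mono_null ?_ hnull⟩
  · have hk : K k ∈ T := hK ▸ Set.mem_range_self k
    rcases hk with h | h
    · rw [h]
      exact ⟨isCompact_empty, pole, fun x hx => absurd hx (by simp)⟩
    · obtain ⟨m, x, hx, h⟩ := Set.mem_iUnion.1 h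
      rw [← h]
      exact (hV m x (htU m hx)).2
  · refine Set.sdiff_subset_sdiff_right ?_
    rintro _ hy
    obtain ⟨m, u, hu, rfl⟩ := Set.mem_iUnion.1 hy
    obtain ⟨x, hx, hux⟩ := Set.mem_iUnion₂.1 (hUt m hu)
    have : φ m '' V m x ∈ T := Or.inr (Set.mem_iUnion.2 ⟨m, x, hx, rfl⟩)
    rw [hK] at this
    obtain ⟨k, hk⟩ := this
    exact Set.mem_iUnion.2 ⟨k, hk ▸ ⟨u, hux, rfl⟩⟩

/-! ### Approximation and comparison of measures by compact sets -/

lemma MeasurableSet.exists_isSigmaCompact_diff_null {X : Type*} [TopologicalSpace X]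
    [MeasurableSpace X] [OpensMeasurableSpace X] [T2Space X] {μ : Measure X}
    [μ.InnerRegularCompactLTTop] {A : Set X} (hA : MeasurableSet A) (h : μ A ≠ ∞) :
    ∃ B ⊆ A, IsSigmaCompact B ∧ μ (A \ B) = 0 := by
  have hex : ∀ m : ℕ, ∃ K ⊆ A, IsCompact K ∧ μ (A \ K) < (m + 1 : ℝ≥0∞)⁻¹ := fun m =>
    hA.exists_isCompact_sdiff_lt h (by simp)
  choose K hKA hK hlt using hex
  refine ⟨⋃ m, K m, Set.iUnion_subset hKA, isSigmaCompact_iUnion_of_isCompact _ hK, ?_⟩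
  have hle : ∀ m : ℕ, μ (A \ ⋃ m, K m) ≤ (m + 1 : ℝ≥0∞)⁻¹ := fun m =>
    (measure_mono (Set.sdiff_subset_sdiff_right (Set.subset_iUnion K m))).trans (hlt m).le
  have hlim : Tendsto (fun m : ℕ => (m + 1 : ℝ≥0∞)⁻¹) atTop (𝓝 0) := by
    have := (tendsto_add_atTop_iff_nat 1).2 ENNReal.tendsto_inv_nat_nhds_zero
    simpa using this
  exact le_antisymm (ge_of_tendsto' hlim hle) zero_le

/-- Inner regularity of `μ` extends the inequality from compact to Borel subsets of each `D k`;
making the `D k` disjoint allows summation. -/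
lemma Measure.le_of_forall_isCompact_le {X : Type*} [TopologicalSpace X] [MeasurableSpace X]
    [OpensMeasurableSpace X] {μ ν : Measure X} [IsFiniteMeasure μ]
    [μ.InnerRegularCompactLTTop] {D : ℕ → Set X} (hD : ∀ k, MeasurableSet (D k))
    (hnull : μ (⋃ k, D k)ᶜ = 0) (h : ∀ k, ∀ K ⊆ D k, IsCompact K → μ K ≤ ν K) : μ ≤ ν := by
  rw [Measure.le_iff]
  intro B hB
  have hBm : ∀ k, MeasurableSet (B ∩ disjointed D k) := fun k =>
    hB.inter (MeasurableSet.disjointed hD k)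
  have hdisj : Pairwise (Function.onFun Disjoint fun k => B ∩ disjointed D k) := fun i j hij =>
    (disjoint_disjointed D hij).mono Set.inter_subset_right Set.inter_subset_right
  have hle : ∀ k, μ (B ∩ disjointed D k) ≤ ν (B ∩ disjointed D k) := by
    intro k
    rw [(hBm k).measure_eq_iSup_isCompact_of_ne_top (measure_ne_top _ _)]
    exact iSup₂_le fun K hK => iSup_le fun hKc =>
      (h k K (hK.trans (Set.inter_subset_right.trans (disjointed_subset D k))) hKc).trans
        (measure_mono hK)
  calc μ B ≤ μ (⋃ k, B ∩ disjointed D k) + μ (⋃ k, D k)ᶜ := by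
        refine (measure_mono ?_).trans (measure_union_le _ _)
        rw [← Set.inter_iUnion, iUnion_disjointed]
        intro x hx
        by_cases hxD : x ∈ ⋃ k, D k
        · exact Or.inl ⟨hx, hxD⟩
        · exact Or.inr hxD
    _ = ∑' k, μ (B ∩ disjointed D k) := by rw [hnull, add_zero, measure_iUnion hdisj hBm]
    _ ≤ ∑' k, ν (B ∩ disjointed D k) := ENNReal.tsum_le_tsum hle
    _ = ν (⋃ k, B ∩ disjointed D k) := (measure_iUnion hdisj hBm).symm
    _ ≤ ν B := measure_mono (Set.iUnion_subset fun k => Set.inter_subset_left)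

/-! ### The Cauchy–Crofton formula -/

namespace Ray

open Classical in
/-- The counting measure on the points of `B` on a ray (zero if there are infinitely many). -/
def crossing (B : Set E3) (l : Ray) : Measure E3 :=
  if hitCount B l = ∞ then 0 else Measure.count.restrict (l.points ∩ B)

lemma crossing_apply {B : Set E3} {l : Ray} (h : hitCount B l ≠ ∞) {C : Set E3}
    (hC : MeasurableSet C) : crossing B l C = hitCount (B ∩ C) l := by
  rw [crossing, if_neg h, Measure.restrict_apply hC, hitCount, Set.inter_comm, Set.inter_assoc]

instance (B : Set E3) (l : Ray) : IsFiniteMeasure (crossing B l) := by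
  constructor
  by_cases h : hitCount B l = ∞
  · simp [crossing, h]
  · rw [crossing_apply h .univ, Set.inter_univ]
    exact lt_top_iff_ne_top.2 h

/-- For closed `C` the set `B ∩ C` is still σ-compact, so its count is measurable; the closed sets
are a π-system generating the Borel sets. -/
lemma measurable_crossing {B : Set E3} (hB : IsSigmaCompact B) : Measurable (crossing B) := by
  have hclosed : ∀ C : Set E3, IsClosed C → Measurable fun l => crossing B l C := by
    intro C hC
    have hset : MeasurableSet {l | hitCount B l = ∞} :=
      measurable_hitCount hB (measurableSet_singleton _)
    have : (fun l => crossing B l C) =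
        fun l => {l | hitCount B l = ∞}.piecewise 0 (hitCount (B ∩ C)) l := by
      classical
      ext l
      by_cases h : hitCount B l = ∞
      · rw [Set.piecewise_eq_of_mem _ _ _ (show l ∈ {l | hitCount B l = ∞} from h)]
        simp [crossing, h]
      · rw [Set.piecewise_eq_of_notMem _ _ _ (show l ∉ {l | hitCount B l = ∞} from h),
          crossing_apply h hC.measurableSet]
    rw [this]
    exact Measurable.piecewise hset measurable_zero
      (measurable_hitCount (hB.inter_of_t2 hC.isLocallyClosed.isSigmaCompact))
  refine Measurable.measure_of_isPiSystem (S := {C | IsClosed C})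
    (BorelSpace.measurable_eq.trans borel_eq_generateFrom_isClosed) isPiSystem_isClosed
    (fun C hC => hclosed C hC) (hclosed _ isClosed_univ)

lemma ae_hitCount_ne_top {B : Set E3} (hB : IsSigmaCompact B) (hfin : surfaceMeasure B ≠ ∞) :
    ∀ᵐ l ∂(Ray.measure), hitCount B l ≠ ∞ := by
  have h : ∫⁻ l, hitCount B l ∂(Ray.measure) ≠ ∞ :=
    ne_top_of_le_ne_top (ENNReal.mul_ne_top hfin (measure_ne_top _ _)) (lintegral_hitCount_le hB)
  filter_upwards [ae_lt_top (measurable_hitCount hB) h] with l hl using hl.ne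

lemma bind_crossing_apply {B : Set E3} (hB : IsSigmaCompact B) (hfin : surfaceMeasure B ≠ ∞)
    {C : Set E3} (hC : MeasurableSet C) :
    Ray.measure.bind (crossing B) C = ∫⁻ l, hitCount (B ∩ C) l ∂(Ray.measure) := by
  rw [Measure.bind_apply hC (measurable_crossing hB).aemeasurable]
  refine lintegral_congr_ae ?_
  filter_upwards [ae_hitCount_ne_top hB hfin] with l hl using crossing_apply hl hC

lemma isFiniteMeasure_bind_crossing {B : Set E3} (hB : IsSigmaCompact B)
    (hfin : surfaceMeasure B ≠ ∞) : IsFiniteMeasure (Ray.measure.bind (crossing B)) := by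
  constructor
  rw [bind_crossing_apply hB hfin .univ, Set.inter_univ]
  exact (lintegral_hitCount_le hB).trans_lt
    (ENNReal.mul_lt_top hfin.lt_top (measure_lt_top _ _))

lemma bind_crossing_null {B : Set E3} (hB : IsSigmaCompact B) (hfin : surfaceMeasure B ≠ ∞)
    {C : Set E3} (hC : MeasurableSet C) (h : surfaceMeasure (B ∩ C) = 0) :
    Ray.measure.bind (crossing B) C = 0 := by
  rw [bind_crossing_apply hB hfin hC]
  have h0 : ∀ᵐ l ∂(Ray.measure), l ∉ hits (B ∩ C) :=
    measure_eq_zero_iff_ae_notMem.1 (measure_hits_of_null h)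
  rw [lintegral_congr_ae (g := 0), Pi.zero_def, lintegral_zero]
  filter_upwards [h0] with l hl
  rw [hitCount, Set.not_nonempty_iff_eq_empty.1 hl]
  simp

/-- The Cauchy–Crofton formula, as an identity of measures on a rectifiable surface. -/
theorem bind_crossing_eq {S B : Set E3} (hS : IsSurface S) (hBS : B ⊆ S) (hB : IsSigmaCompact B)
    (hnull : surfaceMeasure (S \ B) = 0) :
    Ray.measure.bind (crossing B) = croftonConst • surfaceMeasure.restrict S := by
  have hfin : surfaceMeasure B ≠ ∞ :=
    ne_top_of_le_ne_top hS.area_lt_top.ne (measure_mono hBS)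
  set μ := Ray.measure.bind (crossing B) with hμ
  set ν := surfaceMeasure.restrict S with hν
  have : IsFiniteMeasure μ := isFiniteMeasure_bind_crossing hB hfin
  have : IsFiniteMeasure ν := ⟨by simpa [hν] using hS.area_lt_top⟩
  -- The estimates for flat compact sets become inequalities between measures. The band error stands
  -- on the right of the lower bound, which avoids truncated subtraction.
  have key : ∀ η : ℝ, 0 < η → η < 1 →
      μ ≤ (ENNReal.ofReal ((1 + η) ^ 2) * croftonConst + equatorBand η) • ν ∧
      (ENNReal.ofReal ((1 - η) ^ 2) * croftonConst) • ν ≤ μ + equatorBand η • ν := by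
    intro η hη0 hη1
    obtain ⟨K, hK, hKnull⟩ := hS.exists_flat_cover (ε := η ^ 2) (by positivity)
    have hDm : ∀ k, MeasurableSet (B ∩ K k) := fun k =>
      hB.measurableSet.inter (hK k).1.measurableSet
    have hrest : surfaceMeasure (S \ ⋃ k, B ∩ K k) = 0 := by
      refine measure_mono_null ?_ (measure_union_null hnull hKnull)
      rw [← Set.inter_iUnion]
      intro x hx
      by_cases hxB : x ∈ B
      · exact Or.inr ⟨hx.1, fun h => hx.2 ⟨hxB, h⟩⟩
      · exact Or.inl ⟨hx.1, hxB⟩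
    have hνnull : ν (⋃ k, B ∩ K k)ᶜ = 0 := by
      rw [hν, Measure.restrict_apply (MeasurableSet.iUnion hDm).compl, Set.inter_comm]
      exact hrest
    have hμnull : μ (⋃ k, B ∩ K k)ᶜ = 0 :=
      bind_crossing_null hB hfin (MeasurableSet.iUnion hDm).compl
        (measure_mono_null (Set.inter_subset_inter_left _ hBS) hrest)
    have hμK : ∀ k, ∀ C ⊆ B ∩ K k, IsCompact C → μ C = ∫⁻ l, hitCount C l ∂(Ray.measure) :=
      fun k C hC hCc => by
        rw [hμ, bind_crossing_apply hB hfin hCc.measurableSet,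
          Set.inter_eq_right.2 (hC.trans Set.inter_subset_left)]
    have hνK : ∀ k, ∀ C ⊆ B ∩ K k, IsCompact C → ν C = surfaceMeasure C := fun k C hC hCc => by
      rw [hν, Measure.restrict_apply hCc.measurableSet,
        Set.inter_eq_left.2 (hC.trans (Set.inter_subset_left.trans hBS))]
    constructor
    · refine Measure.le_of_forall_isCompact_le hDm hμnull fun k C hC hCc => ?_
      obtain ⟨n, hn⟩ := (hK k).2
      rw [hμK k C hC hCc, Measure.smul_apply, smul_eq_mul, hνK k C hC hCc]
      exact lintegral_hitCount_le_of_isFlat hη0 hη1 hCc (hn.mono (hC.trans Set.inter_subset_right))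
    · have : IsFiniteMeasure ((ENNReal.ofReal ((1 - η) ^ 2) * croftonConst) • ν) :=
        ν.smul_finite (ENNReal.mul_ne_top (by simp) croftonConst_ne_top)
      refine Measure.le_of_forall_isCompact_le hDm
        (by rw [Measure.smul_apply, hνnull, smul_zero]) fun k C hC hCc => ?_
      obtain ⟨n, hn⟩ := (hK k).2
      rw [Measure.add_apply, hμK k C hC hCc, Measure.smul_apply, Measure.smul_apply, smul_eq_mul,
        smul_eq_mul, hνK k C hC hCc]
      exact le_lintegral_hitCount_of_isFlat hη0 hη1 hCc (hn.mono (hC.trans Set.inter_subset_right))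
  -- As `η → 0`, the factors `(1 ± η) ^ 2` tend to `1` and the band term to `0`, so the two bounds
  -- meet.
  have hev : ∀ᶠ η : ℝ in 𝓝[>] 0, 0 < η ∧ η < 1 := Ioo_mem_nhdsGT one_pos
  have hsq : ∀ s : ℝ, Tendsto (fun η : ℝ => ENNReal.ofReal ((1 + s * η) ^ 2) * croftonConst)
      (𝓝[>] 0) (𝓝 croftonConst) := by
    intro s
    have h1 : Tendsto (fun η : ℝ => ENNReal.ofReal ((1 + s * η) ^ 2)) (𝓝[>] 0) (𝓝 1) := by
      have hc : Continuous fun η : ℝ => ENNReal.ofReal ((1 + s * η) ^ 2) :=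
        ENNReal.continuous_ofReal.comp (by fun_prop)
      have := (hc.tendsto 0).mono_left (nhdsWithin_le_nhds (s := Set.Ioi 0))
      simpa using this
    simpa using ENNReal.Tendsto.mul_const h1 (Or.inl one_ne_zero) (b := croftonConst)
  refine le_antisymm (Measure.le_iff.2 fun A hA => ?_) (Measure.le_iff.2 fun A hA => ?_)
  · have hlim := ENNReal.Tendsto.mul_const ((hsq 1).add tendsto_equatorBand) (b := ν A)
      (Or.inr (measure_ne_top _ _))
    rw [add_zero] at hlim
    refine ge_of_tendsto hlim ?_
    filter_upwards [hev] with η hη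
    simpa using (key η hη.1 hη.2).1 A
  · have hlim1 := ENNReal.Tendsto.mul_const (hsq (-1)) (b := ν A) (Or.inr (measure_ne_top _ _))
    have hlim2 := (ENNReal.Tendsto.mul_const tendsto_equatorBand (b := ν A)
      (Or.inr (measure_ne_top _ _))).const_add (μ A)
    rw [zero_mul, add_zero] at hlim2
    refine le_of_tendsto_of_tendsto hlim1 hlim2 ?_
    filter_upwards [hev] with η hη
    simpa [sub_eq_add_neg] using (key η hη.1 hη.2).2 A

end Ray

/-! ### Laws of large numbers for sample means -/

section SampleMean

/-- The mean of `f` over the first `N` points of a sequence. -/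
def sampleMean {E : Type*} (f : E → ℝ) (N : ℕ) (x : ℕ → E) : ℝ :=
  (∑ j ∈ Finset.range N, f (x j)) / N

variable {E : Type*} [MeasurableSpace E]

lemma measurable_sampleMean {f : E → ℝ} (hf : Measurable f) (N : ℕ) :
    Measurable (sampleMean f N) := by
  unfold sampleMean; fun_prop

variable {Q : Measure E} [IsProbabilityMeasure Q]

lemma integral_eval_infinitePi {f : E → ℝ} (hf : Measurable f) (j : ℕ) :
    ∫ x, f (x j) ∂Measure.infinitePi (fun _ : ℕ => Q) = ∫ y, f y ∂Q :=
  (measurePreserving_eval_infinitePi (fun _ : ℕ => Q) j).hasLaw.integral_comp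
    hf.aestronglyMeasurable

lemma integrable_eval_infinitePi {f : E → ℝ} (hfi : Integrable f Q) (j : ℕ) :
    Integrable (fun x : ℕ → E => f (x j)) (Measure.infinitePi (fun _ : ℕ => Q)) :=
  (measurePreserving_eval_infinitePi (fun _ : ℕ => Q) j).integrable_comp_of_integrable hfi

lemma ae_tendsto_sampleMean {f : E → ℝ} (hf : Measurable f) (hfi : Integrable f Q) :
    ∀ᵐ x ∂Measure.infinitePi (fun _ : ℕ => Q),
      Tendsto (fun N => sampleMean f N x) atTop (𝓝 (∫ y, f y ∂Q)) := by
  have hindep : iIndepFun (fun (j : ℕ) (x : ℕ → E) => f (x j))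
      (Measure.infinitePi (fun _ : ℕ => Q)) := iIndepFun_infinitePi fun _ => hf
  have h := strong_law_ae_real (fun (j : ℕ) (x : ℕ → E) => f (x j))
    (integrable_eval_infinitePi hfi 0) (fun i j hij => hindep.indepFun hij) (fun j =>
      ⟨(hf.comp (measurable_pi_apply j)).aemeasurable,
        (hf.comp (measurable_pi_apply 0)).aemeasurable,
        by
          have hmap : ∀ i : ℕ, (Measure.infinitePi (fun _ : ℕ => Q)).map
              (fun x : ℕ → E => f (x i)) = Q.map f := fun i => by
            conv_rhs => rw [← (measurePreserving_eval_infinitePi (fun _ : ℕ => Q) i).map_eq,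
              Measure.map_map hf (measurable_pi_apply i)]
            rfl
          rw [hmap, hmap]⟩)
  rw [integral_eval_infinitePi hf 0] at h
  exact h

/-- Chebyshev's inequality, with the variance bounded by `T ^ 2`: the bound does not involve `Q`, so
it survives when the law varies with `M`. -/
lemma measureReal_sampleMean_sub_le {g : E → ℝ} (hg : Measurable g) {T : ℝ}
    (hT : ∀ y, |g y| ≤ T) {c : ℝ} (hc : 0 < c) {N : ℕ} (hN : 0 < N) :
    (Measure.infinitePi (fun _ : ℕ => Q)).real {x | c ≤ |sampleMean g N x - ∫ y, g y ∂Q|} ≤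
      T ^ 2 / (N * c ^ 2) := by
  set μ := Measure.infinitePi (fun _ : ℕ => Q) with hμ
  have hN' : (0 : ℝ) < N := by exact_mod_cast hN
  let Z : ℕ → (ℕ → E) → ℝ := fun j x => g (x j)
  have hZm : ∀ j, Measurable (Z j) := fun j => hg.comp (measurable_pi_apply j)
  have hindep : iIndepFun Z μ := iIndepFun_infinitePi fun _ => hg
  have hL : ∀ j, MemLp (Z j) 2 μ := fun j =>
    MemLp.of_bound (hZm j).aestronglyMeasurable T (ae_of_all _ fun x => hT (x j))
  have hsum : MemLp (∑ j ∈ Finset.range N, Z j) 2 μ := memLp_finsetSum' _ fun j _ => hL j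
  have hvar : variance (∑ j ∈ Finset.range N, Z j) μ ≤ N * T ^ 2 := by
    rw [IndepFun.variance_sum (fun j _ => hL j) fun i _ j _ hij => hindep.indepFun hij]
    calc ∑ j ∈ Finset.range N, variance (Z j) μ ≤ ∑ _j ∈ Finset.range N, T ^ 2 := by
          refine Finset.sum_le_sum fun j _ => ?_
          have := variance_le_sq_of_bounded (μ := μ) (X := Z j) (a := -T) (b := T)
            (ae_of_all _ fun x => abs_le.1 (hT (x j))) (hZm j).aemeasurable
          calc _ ≤ _ := this
            _ = T ^ 2 := by ring
      _ = N * T ^ 2 := by simp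
  have hmean : μ[∑ j ∈ Finset.range N, Z j] = N * ∫ y, g y ∂Q := by
    simp only [Finset.sum_apply]
    rw [integral_finsetSum _ fun j _ => (hL j).integrable (by norm_num)]
    simp [Z, hμ, integral_eval_infinitePi hg]
  have hcheb := meas_ge_le_variance_div_sq hsum (c := N * c) (by positivity)
  have hset : {x | c ≤ |sampleMean g N x - ∫ y, g y ∂Q|} =
      {x | N * c ≤ |(∑ j ∈ Finset.range N, Z j) x - μ[∑ j ∈ Finset.range N, Z j]|} := by
    ext x
    have : (∑ j ∈ Finset.range N, Z j) x - μ[∑ j ∈ Finset.range N, Z j] =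
        N * (sampleMean g N x - ∫ y, g y ∂Q) := by
      rw [hmean, sampleMean, Finset.sum_apply, mul_sub, mul_div_cancel₀ _ hN'.ne']
    simp only [Set.mem_ofPred_eq]
    rw [this, abs_mul, abs_of_pos hN', mul_le_mul_iff_right₀ hN']
  rw [hset]
  calc _ ≤ variance (∑ j ∈ Finset.range N, Z j) μ / (N * c) ^ 2 :=
        ENNReal.toReal_le_of_le_ofReal (div_nonneg (variance_nonneg _ _) (by positivity)) hcheb
    _ ≤ N * T ^ 2 / (N * c) ^ 2 := by gcongr
    _ = T ^ 2 / (N * c ^ 2) := by field_simp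

/-- Markov's inequality. The bound is independent of `N`, and it controls the part of `f` removed by
truncation. -/
lemma measureReal_sampleMean_le {h : E → ℝ} (hh : Measurable h) (hhi : Integrable h Q) {c : ℝ}
    (hc : 0 < c) (N : ℕ) :
    (Measure.infinitePi (fun _ : ℕ => Q)).real {x | c ≤ |sampleMean h N x|} ≤
      (∫ y, |h y| ∂Q) / c := by
  set μ := Measure.infinitePi (fun _ : ℕ => Q) with hμ
  have hInt : ∀ j, Integrable (fun x : ℕ → E => |h (x j)|) μ := fun j =>
    (integrable_eval_infinitePi hhi j).abs
  have hmint : Integrable (fun x => |sampleMean h N x|) μ :=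
    ((integrable_finsetSum _ fun j _ => integrable_eval_infinitePi hhi j).div_const _).abs
  have hle : ∫ x, |sampleMean h N x| ∂μ ≤ ∫ y, |h y| ∂Q := by
    calc ∫ x, |sampleMean h N x| ∂μ ≤ ∫ x, (∑ j ∈ Finset.range N, |h (x j)|) / N ∂μ := by
          refine integral_mono hmint ((integrable_finsetSum _ fun j _ => hInt j).div_const _)
            fun x => ?_
          simp only [sampleMean, abs_div, Nat.abs_cast]
          gcongr
          exact Finset.abs_sum_le_sum_abs _ _
      _ = (N : ℝ) * (∫ y, |h y| ∂Q) / N := by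
          rw [integral_div, integral_finsetSum _ fun j _ => hInt j]
          simp [hμ, integral_eval_infinitePi hh.abs]
      _ ≤ ∫ y, |h y| ∂Q := by
          have : 0 ≤ ∫ y, |h y| ∂Q := integral_nonneg fun _ => abs_nonneg _
          rcases N.eq_zero_or_pos with rfl | hN
          · simpa using this
          · have : (N : ℝ) ≠ 0 := by exact_mod_cast hN.ne'
            exact (mul_div_cancel_left₀ _ this).le
  rw [le_div_iff₀ hc, mul_comm]
  exact (mul_meas_ge_le_integral_of_nonneg (ae_of_all _ fun _ => abs_nonneg _) hmint c).trans hle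

end SampleMean

/-- Truncation of a real number to the interval `[-T, T]`. -/
def clip (T y : ℝ) : ℝ := max (-T) (min y T)

lemma measurable_clip (T : ℝ) : Measurable (clip T) := by unfold clip; fun_prop

lemma abs_clip_le {T : ℝ} (hT : 0 ≤ T) (y : ℝ) : |clip T y| ≤ T := by
  unfold clip
  rw [abs_le]
  exact ⟨le_max_left _ _, max_le (by linarith) (min_le_right _ _)⟩

lemma abs_sub_clip_le {T : ℝ} (hT : 0 ≤ T) (y : ℝ) : |y - clip T y| ≤ |y| := by
  unfold clip
  rcases max_cases (-T) (min y T) with h | h <;> rcases min_cases y T with h' | h' <;>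
    rcases abs_cases y with h'' | h'' <;> rw [abs_le] <;> constructor <;> linarith

lemma clip_eq_self {T y : ℝ} (h : |y| ≤ T) : clip T y = y := by
  rw [abs_le] at h
  rw [clip, min_eq_left h.2, max_eq_right h.1]

lemma tendsto_integral_abs_sub_clip {E : Type*} [MeasurableSpace E] {μ : Measure E} {f : E → ℝ}
    (hf : Measurable f) (hfi : Integrable f μ) :
    Tendsto (fun T : ℕ => ∫ y, |f y - clip T (f y)| ∂μ) atTop (𝓝 0) := by
  have h := tendsto_integral_of_dominated_convergence (μ := μ)
    (F := fun (T : ℕ) y => |f y - clip T (f y)|) (f := fun _ => 0) (fun y => |f y|)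
    (fun T => ((hf.sub ((measurable_clip T).comp hf)).abs).aestronglyMeasurable) hfi.abs
    (fun T => ae_of_all _ fun y => by
      simpa using abs_sub_clip_le (Nat.cast_nonneg T) (f y))
    (ae_of_all _ fun y => by
      refine tendsto_const_nhds.congr' ?_
      obtain ⟨T₀, hT₀⟩ := exists_nat_ge |f y|
      filter_upwards [eventually_ge_atTop T₀] with T hT
      rw [clip_eq_self (hT₀.trans (by exact_mod_cast hT)), sub_self, abs_zero])
  simpa using h

/-- A weak law of large numbers for the sample means of a varying sequence of laws. -/
lemma tendsto_measure_sampleMean {E : Type*} [MeasurableSpace E] {Q : ℕ → Measure E}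
    (hQ : ∀ᶠ M in atTop, IsProbabilityMeasure (Q M)) {f : E → ℝ} (hf : Measurable f)
    (hfi : ∀ᶠ M in atTop, Integrable f (Q M)) {m : ℝ}
    (hm : Tendsto (fun M => ∫ y, f y ∂Q M) atTop (𝓝 m)) {e : ℕ → ℝ}
    (he : ∀ T : ℕ, Tendsto (fun M => ∫ y, |f y - clip T (f y)| ∂Q M) atTop (𝓝 (e T)))
    (he0 : Tendsto e atTop (𝓝 0)) {ε : ℝ} (hε : 0 < ε) :
    Tendsto (fun p : ℕ × ℕ => Measure.infinitePi (fun _ : ℕ => Q p.1)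
      {x | ε ≤ |sampleMean f p.2 x - m|}) (atTop ×ˢ atTop) (𝓝 0) := by
  rw [ENNReal.tendsto_nhds_zero]
  intro a ha
  obtain ⟨δ, hδ0, hδa⟩ : ∃ δ : ℝ, 0 < δ ∧ ENNReal.ofReal δ ≤ a := by
    rcases eq_or_ne a ∞ with rfl | h
    · exact ⟨1, one_pos, le_top⟩
    · exact ⟨a.toReal, ENNReal.toReal_pos ha.ne' h, by rw [ENNReal.ofReal_toReal h]⟩
  -- Four errors share `ε`: the fluctuation of the truncated mean, the sample mean of the tail, the
  -- bias of truncation, and the distance from the mean under `Q M` to `m`. The bound `τ` on the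
  -- tail keeps the bias below `c` and the Markov bound below `δ / 2`.
  set c := ε / 4 with hc
  have hc0 : 0 < c := by positivity
  set τ := min c (c * (δ / 2)) with hτ
  have hτ0 : 0 < τ := lt_min hc0 (by positivity)
  -- The level `T` is fixed before `M` and `N` grow; `he` and `he0` together play the role of
  -- uniform integrability.
  obtain ⟨T, hT⟩ := (he0.eventually_lt_const hτ0).exists
  have h1 : ∀ᶠ M in atTop, |∫ y, f y ∂Q M - m| < c := by
    have := (hm.sub_const m).abs
    rw [sub_self, abs_zero] at this
    exact this.eventually_lt_const hc0
  have h2 : ∀ᶠ N : ℕ in atTop, (T : ℝ) ^ 2 / (N * c ^ 2) < δ / 2 := by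
    have : Tendsto (fun N : ℕ => (T : ℝ) ^ 2 / c ^ 2 / N) atTop (𝓝 0) :=
      tendsto_const_div_atTop_nhds_zero_nat _
    filter_upwards [this.eventually_lt_const (half_pos hδ0)] with N hN
    rwa [mul_comm, ← div_div]
  have hM := hQ.and (hfi.and (h1.and ((he T).eventually_lt_const hT)))
  filter_upwards [hM.prod_mk (h2.and (eventually_gt_atTop 0))] with p hp
  obtain ⟨⟨hprob, hInt, hpm, hpT⟩, hN, hN0⟩ := hp
  set μ := Measure.infinitePi (fun _ : ℕ => Q p.1) with hμ
  set g : E → ℝ := fun y => clip T (f y) with hg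
  have hgm : Measurable g := (measurable_clip T).comp hf
  have hgT : ∀ y, |g y| ≤ T := fun y => abs_clip_le (Nat.cast_nonneg T) _
  have hgi : Integrable g (Q p.1) :=
    Integrable.of_bound hgm.aestronglyMeasurable T (ae_of_all _ hgT)
  have hsub : {x | ε ≤ |sampleMean f p.2 x - m|} ⊆
      {x | c ≤ |sampleMean g p.2 x - ∫ y, g y ∂Q p.1|} ∪
        {x | c ≤ |sampleMean (fun y => f y - g y) p.2 x|} := by
    intro x hx
    by_contra hcon
    rw [Set.mem_union, not_or] at hcon
    have ha : |sampleMean g p.2 x - ∫ y, g y ∂Q p.1| < c := not_le.1 hcon.1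
    have hb : |sampleMean (fun y => f y - g y) p.2 x| < c := not_le.1 hcon.2
    have hd : |∫ y, f y ∂Q p.1 - ∫ y, g y ∂Q p.1| < c := by
      rw [← integral_sub hInt hgi]
      exact (abs_integral_le_integral_abs).trans_lt (hpT.trans_le (min_le_left _ _))
    have hs : sampleMean (fun y => f y - g y) p.2 x = sampleMean f p.2 x - sampleMean g p.2 x := by
      simp only [sampleMean, Finset.sum_sub_distrib, sub_div]
    have hx' : ε ≤ |sampleMean f p.2 x - m| := hx
    rw [hs] at hb
    rw [abs_lt] at ha hb hd hpm
    have : |sampleMean f p.2 x - m| < ε := by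
      rw [abs_lt]; constructor <;> linarith
    linarith
  have hbound : μ.real {x | ε ≤ |sampleMean f p.2 x - m|} ≤ δ := by
    calc _ ≤ _ := measureReal_mono hsub
      _ ≤ _ := measureReal_union_le _ _
      _ ≤ (T : ℝ) ^ 2 / (p.2 * c ^ 2) + (∫ y, |f y - g y| ∂Q p.1) / c :=
        add_le_add (measureReal_sampleMean_sub_le hgm hgT hc0 hN0)
          (measureReal_sampleMean_le (hf.sub hgm) (hInt.sub hgi) hc0 _)
      _ ≤ δ / 2 + δ / 2 := by
        refine add_le_add hN.le ?_
        rw [div_le_iff₀ hc0, mul_comm]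
        exact (hpT.trans_le (min_le_right _ _)).le
      _ = δ := by ring
  refine le_trans ?_ hδa
  rw [← ofReal_measureReal]
  exact ENNReal.ofReal_le_ofReal hbound

/-! ### Resampling from a kernel along an i.i.d. sequence -/

section Resampling

variable {Y E Ω : Type*} [MeasurableSpace Y] [MeasurableSpace E] [MeasurableSpace Ω]

/-- The sum of the measures of a kernel at finitely many points. -/
def pool (κ : Kernel Y E) {M : ℕ} (r : Fin M → Y) : Measure E := ∑ i, κ (r i)

/-- The normalized sum of the measures of a kernel at finitely many points. -/
def mix (κ : Kernel Y E) {M : ℕ} (r : Fin M → Y) : Measure E := (pool κ r Set.univ)⁻¹ • pool κ r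

/-- For every `M`, the points `X M j` are drawn independently from the normalized sum of the
measures that a kernel attaches to the first `M` terms of a sequence of independent and identically
distributed random variables. -/
structure IsResampling [StandardBorelSpace E] [Nonempty E] (κ : Kernel Y E) (ρ : Measure Y)
    (P : Measure Ω) [IsFiniteMeasure P] (ℓ : ℕ → Ω → Y) (X : ℕ → ℕ → Ω → E) : Prop where
  measurable_source : ∀ i, Measurable (ℓ i)
  iIndepFun : iIndepFun ℓ P
  map_eq : ∀ i, P.map (ℓ i) = ρ
  measurable_point : ∀ M j, Measurable (X M j)
  condDistrib_eq : ∀ M, ∀ᵐ r ∂(P.map fun ω (i : Fin M) => ℓ i ω), pool κ r Set.univ ≠ 0 →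
    condDistrib (fun ω j => X M j ω) (fun ω (i : Fin M) => ℓ i ω) P r =
      Measure.infinitePi fun _ : ℕ => mix κ r

section Pool

variable {κ : Kernel Y E} {M : ℕ}

lemma pool_apply (r : Fin M → Y) (s : Set E) : pool κ r s = ∑ i, κ (r i) s := by
  simp [pool]

lemma measurable_pool_univ : Measurable fun r : Fin M → Y => pool κ r Set.univ := by
  simp_rw [pool_apply]
  exact Finset.measurable_sum _ fun i _ =>
    (κ.measurable_coe .univ).comp (measurable_pi_apply i)

lemma integral_mix {r : Fin M → Y} {f : E → ℝ} (hf : ∀ i, Integrable f (κ (r i))) :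
    ∫ x, f x ∂mix κ r = (pool κ r Set.univ).toReal⁻¹ * ∑ i, ∫ x, f x ∂κ (r i) := by
  rw [mix, integral_smul_measure, pool, integral_finsetSum_measure fun i _ => hf i,
    ENNReal.toReal_inv, smul_eq_mul]

lemma integrable_mix {r : Fin M → Y} (h : pool κ r Set.univ ≠ 0) {f : E → ℝ}
    (hf : ∀ i, Integrable f (κ (r i))) : Integrable f (mix κ r) :=
  (integrable_finsetSum_measure.2 fun i _ => hf i).smul_measure (ENNReal.inv_ne_top.2 h)

variable [∀ y, IsFiniteMeasure (κ y)]

instance (r : Fin M → Y) : IsFiniteMeasure (pool κ r) := by unfold pool; infer_instance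

lemma isProbabilityMeasure_mix {r : Fin M → Y} (h : pool κ r Set.univ ≠ 0) :
    IsProbabilityMeasure (mix κ r) :=
  ⟨by rw [mix, Measure.smul_apply, smul_eq_mul, ENNReal.inv_mul_cancel h (measure_ne_top _ _)]⟩

end Pool

namespace IsResampling

variable [StandardBorelSpace E] [Nonempty E] {κ : Kernel Y E}
  {ρ : Measure Y} {P : Measure Ω} [IsProbabilityMeasure P] {ℓ : ℕ → Ω → Y} {X : ℕ → ℕ → Ω → E}

/-- The first `M` terms of the sequence. -/
abbrev source (ℓ : ℕ → Ω → Y) (M : ℕ) (ω : Ω) (i : Fin M) : Y := ℓ i ω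

lemma measurable_sources (h : IsResampling κ ρ P ℓ X) (M : ℕ) : Measurable (source ℓ M) :=
  measurable_pi_lambda _ fun i => h.measurable_source i

lemma measurable_points (h : IsResampling κ ρ P ℓ X) (M : ℕ) :
    Measurable (fun ω j => X M j ω) := measurable_pi_lambda _ fun j => h.measurable_point M j

lemma ae_forall_source (h : IsResampling κ ρ P ℓ X) {p : Y → Prop} (hp : ∀ᵐ y ∂ρ, p y) :
    ∀ᵐ ω ∂P, ∀ i, p (ℓ i ω) :=
  ae_all_iff.2 fun i => ae_of_ae_map (h.measurable_source i).aemeasurable (by rwa [h.map_eq])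

lemma ae_condDistrib_eq (h : IsResampling κ ρ P ℓ X) :
    ∀ᵐ ω ∂P, ∀ M, pool κ (source ℓ M ω) Set.univ ≠ 0 →
      condDistrib (fun ω j => X M j ω) (source ℓ M) P (source ℓ M ω) =
        Measure.infinitePi fun _ : ℕ => mix κ (source ℓ M ω) :=
  ae_all_iff.2 fun M => ae_of_ae_map (h.measurable_sources M).aemeasurable (h.condDistrib_eq M)

lemma ae_tendsto_sum (h : IsResampling κ ρ P ℓ X) {f : E → ℝ} (hf : Measurable f)
    (hfi : Integrable f (ρ.bind κ)) :
    ∀ᵐ ω ∂P, Tendsto (fun M : ℕ => (∑ i : Fin M, ∫ x, f x ∂κ (ℓ i ω)) / M) atTop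
      (𝓝 (∫ x, f x ∂(ρ.bind κ))) := by
  let g : Y → ℝ := fun y => ∫ x, f x ∂κ y
  have hg : Measurable g := (hf.stronglyMeasurable.integral_kernel).measurable
  have hgi : Integrable g ρ := by
    have := ((Measure.integrable_comp_iff hfi.1).1 hfi).2
    refine this.mono hg.aestronglyMeasurable (ae_of_all _ fun y => ?_)
    exact (norm_integral_le_integral_norm _).trans (le_abs_self _)
  have hInt : ∫ x, f x ∂(ρ.bind κ) = ∫ y, g y ∂ρ := by
    have hc : Integrable f ((κ ∘ₖ Kernel.const Unit ρ) ()) := by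
      simpa [Kernel.comp_apply] using hfi
    have := Kernel.integral_comp hc
    simpa [Kernel.comp_apply] using this
  have hgi' : ∀ i, Integrable (fun ω => g (ℓ i ω)) P := fun i => by
    have : Integrable g (P.map (ℓ i)) := by rwa [h.map_eq]
    exact this.comp_measurable (h.measurable_source i)
  have hslln := strong_law_ae_real (fun i ω => g (ℓ i ω)) (hgi' 0)
    (fun i j hij => (h.iIndepFun.indepFun hij).comp hg hg) fun i =>
      ((IdentDistrib.mk (h.measurable_source i).aemeasurable (h.measurable_source 0).aemeasurable
        (by rw [h.map_eq, h.map_eq])).comp hg)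
  have hmean : ∫ ω, g (ℓ 0 ω) ∂P = ∫ y, g y ∂ρ := by
    rw [← h.map_eq 0, integral_map (h.measurable_source 0).aemeasurable hg.aestronglyMeasurable]
  filter_upwards [hslln] with ω hω
  rw [hInt, ← hmean]
  refine hω.congr fun M => ?_
  rw [Finset.sum_range]

/-- The joint law of sources and points is the law of the sources composed with the conditional law
of the points, so a property that holds almost surely for the i.i.d. model holds for the actual
points. -/
lemma ae_points (h : IsResampling κ ρ P ℓ X) {M : ℕ} {p : (Fin M → Y) × (ℕ → E) → Prop}
    (hp : MeasurableSet {q | p q})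
    (hae : ∀ᵐ ω ∂P, pool κ (source ℓ M ω) Set.univ ≠ 0 →
      ∀ᵐ x ∂Measure.infinitePi (fun _ : ℕ => mix κ (source ℓ M ω)), p (source ℓ M ω, x)) :
    ∀ᵐ ω ∂P, pool κ (source ℓ M ω) Set.univ ≠ 0 → p (source ℓ M ω, fun j => X M j ω) := by
  have hpool : MeasurableSet {q : (Fin M → Y) × (ℕ → E) | pool κ q.1 Set.univ ≠ 0} :=
    (measurable_pool_univ.comp measurable_fst) (measurableSet_singleton 0).compl
  have hp' : MeasurableSet {q : (Fin M → Y) × (ℕ → E) | pool κ q.1 Set.univ ≠ 0 → p q} := by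
    have : {q : (Fin M → Y) × (ℕ → E) | pool κ q.1 Set.univ ≠ 0 → p q} =
        {q | pool κ q.1 Set.univ ≠ 0}ᶜ ∪ {q | p q} := by
      ext q; simp [imp_iff_not_or]
    rw [this]
    exact hpool.compl.union hp
  have hjoint : ∀ᵐ q ∂(P.map fun ω => (source ℓ M ω, fun j => X M j ω)),
      pool κ q.1 Set.univ ≠ 0 → p q := by
    rw [← compProd_map_condDistrib (h.measurable_points M).aemeasurable,
      Measure.ae_compProd_iff hp']
    have hm := Kernel.measurable_kernel_prodMk_left
      (κ := condDistrib (fun ω j => X M j ω) (source ℓ M) P) hp'.compl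
    refine (ae_map_iff (h.measurable_sources M).aemeasurable
      (hm (measurableSet_singleton 0))).2 ?_
    filter_upwards [hae, h.ae_condDistrib_eq] with ω h1 h2
    change ∀ᵐ x ∂_, _
    by_cases h0 : pool κ (source ℓ M ω) Set.univ = 0
    · exact ae_of_all _ fun x hx => absurd h0 hx
    · rw [h2 M h0]
      filter_upwards [h1 h0] with x hx _ using hx
  exact ae_of_ae_map ((h.measurable_sources M).prodMk (h.measurable_points M)).aemeasurable hjoint

variable [∀ y, IsFiniteMeasure (κ y)]

lemma ae_tendsto_sampleMean (h : IsResampling κ ρ P ℓ X) {f : E → ℝ} (hf : Measurable f)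
    (hfi : Integrable f (ρ.bind κ)) :
    ∀ᵐ ω ∂P, ∀ M, pool κ (source ℓ M ω) Set.univ ≠ 0 →
      Tendsto (fun N => sampleMean f N fun j => X M j ω) atTop
        (𝓝 (∫ x, f x ∂mix κ (source ℓ M ω))) := by
  rw [ae_all_iff]
  intro M
  -- This is the mean under `mix`, written so that its measurability in `r` is evident.
  let I : (Fin M → Y) → ℝ := fun r => (pool κ r Set.univ).toReal⁻¹ * ∑ i, ∫ x, f x ∂κ (r i)
  have hI : Measurable I := by
    refine (measurable_pool_univ.ennreal_toReal.inv).mul (Finset.measurable_sum _ fun i _ => ?_)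
    exact (hf.stronglyMeasurable.integral_kernel).measurable.comp (measurable_pi_apply i)
  have hInt := h.ae_forall_source ((Measure.integrable_comp_iff hfi.1).1 hfi).1
  have key := h.ae_points (M := M)
    (p := fun q => Tendsto (fun N => sampleMean f N q.2) atTop (𝓝 (I q.1)))
    (measurableSet_tendsto_fun (fun N => (measurable_sampleMean hf N).comp measurable_snd)
      (hI.comp measurable_fst)) (by
        filter_upwards [hInt] with ω hω h0
        have := isProbabilityMeasure_mix h0
        have hi := _root_.ae_tendsto_sampleMean hf (integrable_mix h0 fun i => hω i)
        rwa [integral_mix fun i => hω i] at hi)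
  filter_upwards [key, hInt] with ω h1 h2 h0
  rw [integral_mix fun i => h2 i]
  exact h1 h0

/-- This permits replacing an integrable function by a Borel version without changing the sample
means. -/
lemma ae_notMem_null (h : IsResampling κ ρ P ℓ X) {W : Set E} (hW : MeasurableSet W)
    (hnull : ρ.bind κ W = 0) :
    ∀ᵐ ω ∂P, ∀ M, pool κ (source ℓ M ω) Set.univ ≠ 0 → ∀ j, X M j ω ∉ W := by
  have hκ : ∀ᵐ y ∂ρ, κ y W = 0 := by
    rw [Measure.bind_apply hW κ.aemeasurable, lintegral_eq_zero_iff (κ.measurable_coe hW)] at hnull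
    exact hnull
  rw [ae_all_iff]
  intro M
  refine h.ae_points (M := M) (p := fun q => ∀ j, q.2 j ∉ W) ?_ ?_
  · have : {q : (Fin M → Y) × (ℕ → E) | ∀ j, q.2 j ∉ W} = ⋂ j, {q | q.2 j ∈ W}ᶜ := by
      ext q; simp
    rw [this]
    exact .iInter fun j => (((measurable_pi_apply j).comp measurable_snd) hW).compl
  · filter_upwards [h.ae_forall_source hκ] with ω hω h0
    have := isProbabilityMeasure_mix h0
    have hmix : mix κ (source ℓ M ω) W = 0 := by
      have hsum : ∑ i, κ (source ℓ M ω i) W = 0 := Finset.sum_eq_zero fun i _ => hω i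
      rw [mix, Measure.smul_apply, pool_apply _ W, hsum, smul_zero]
    rw [ae_all_iff]
    intro j
    rw [← (measurePreserving_eval_infinitePi (fun _ : ℕ => mix κ (source ℓ M ω)) j).measure_preimage
      hW.nullMeasurableSet] at hmix
    exact measure_eq_zero_iff_ae_notMem.1 hmix

variable [IsFiniteMeasure (ρ.bind κ)]

lemma ae_tendsto_pool (h : IsResampling κ ρ P ℓ X) :
    ∀ᵐ ω ∂P, Tendsto (fun M : ℕ => (pool κ (source ℓ M ω) Set.univ).toReal / M) atTop
      (𝓝 ((ρ.bind κ).real Set.univ)) := by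
  filter_upwards [h.ae_tendsto_sum (f := fun _ => 1) measurable_const (integrable_const _)]
    with ω hω
  simp only [integral_const, smul_eq_mul, mul_one] at hω
  refine hω.congr fun M => ?_
  rw [pool_apply, ENNReal.toReal_sum fun i _ => measure_ne_top _ _]
  rfl

variable [NeZero (ρ.bind κ)]

lemma ae_eventually_pool_ne_zero (h : IsResampling κ ρ P ℓ X) :
    ∀ᵐ ω ∂P, ∀ᶠ M in atTop, pool κ (source ℓ M ω) Set.univ ≠ 0 := by
  filter_upwards [h.ae_tendsto_pool] with ω hω
  filter_upwards [hω.eventually_const_lt (measureReal_univ_pos)] with M hM h0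
  simp [h0] at hM

/-- The mean under `mix` is a quotient of two sums over the first `M` sources; after division by
`M`, each converges by the strong law. -/
lemma ae_tendsto_integral_mix (h : IsResampling κ ρ P ℓ X) {f : E → ℝ} (hf : Measurable f)
    (hfi : Integrable f (ρ.bind κ)) :
    ∀ᵐ ω ∂P, Tendsto (fun M => ∫ x, f x ∂mix κ (source ℓ M ω)) atTop
      (𝓝 (((ρ.bind κ).real Set.univ)⁻¹ * ∫ x, f x ∂(ρ.bind κ))) := by
  filter_upwards [h.ae_tendsto_sum hf hfi, h.ae_tendsto_pool,
    h.ae_forall_source ((Measure.integrable_comp_iff hfi.1).1 hfi).1] with ω h1 h2 h3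
  refine ((h2.inv₀ measureReal_univ_pos.ne').mul h1).congr' ?_
  filter_upwards [eventually_gt_atTop 0] with M hM
  have hM' : (M : ℝ) ≠ 0 := by exact_mod_cast hM.ne'
  rw [integral_mix fun i => h3 i]
  rw [inv_div, div_mul_div_comm, mul_comm (M : ℝ), mul_div_mul_right _ _ hM', inv_mul_eq_div]

/-- The points become uniformly distributed with respect to the mean of the kernel. -/
theorem tendsto_measure_point (h : IsResampling κ ρ P ℓ X) (j : ℕ) {B : Set E}
    (hB : MeasurableSet B) :
    Tendsto (fun M => P {ω | X M j ω ∈ B}) atTop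
      (𝓝 (ρ.bind κ B / ρ.bind κ Set.univ)) := by
  have hm : MeasurableSet {x : ℕ → E | x j ∈ B} := measurable_pi_apply j hB
  have heq : ∀ M, P {ω | X M j ω ∈ B} = ∫⁻ ω, condDistrib (fun ω j => X M j ω) (source ℓ M) P
      (source ℓ M ω) {x : ℕ → E | x j ∈ B} ∂P := by
    intro M
    have := setLIntegral_preimage_condDistrib (h.measurable_sources M)
      (h.measurable_points M).aemeasurable hm (μ := P) (t := Set.univ) .univ
    simpa using this.symm
  have hlim : ρ.bind κ B / ρ.bind κ Set.univ =
      ∫⁻ _, ρ.bind κ B / ρ.bind κ Set.univ ∂P := by simp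
  simp_rw [heq]
  rw [hlim]
  -- The probability is the expectation of a conditional probability, which eventually equals the
  -- `mix`-measure of `B` and is bounded by `1`.
  refine tendsto_lintegral_of_dominated_convergence (fun _ => 1) (fun M => ?_)
    (fun M => ae_of_all _ fun ω => prob_le_one) (by simp) ?_
  · exact ((condDistrib _ _ P).measurable_coe hm).comp (h.measurable_sources M)
  filter_upwards [h.ae_condDistrib_eq, h.ae_eventually_pool_ne_zero,
    h.ae_tendsto_integral_mix (f := B.indicator 1) (measurable_one.indicator hB)
      ((integrable_const (1 : ℝ)).indicator hB)] with ω h1 h2 h3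
  have h4 := ENNReal.tendsto_ofReal h3
  have h5 : ENNReal.ofReal (((ρ.bind κ).real Set.univ)⁻¹ * ∫ x, B.indicator 1 x ∂(ρ.bind κ)) =
      ρ.bind κ B / ρ.bind κ Set.univ := by
    rw [integral_indicator_one hB, ENNReal.ofReal_mul (by positivity),
      ENNReal.ofReal_inv_of_pos measureReal_univ_pos, ofReal_measureReal, ofReal_measureReal,
      ENNReal.div_eq_inv_mul]
  rw [h5] at h4
  refine h4.congr' ?_
  filter_upwards [h2] with M hM
  have := isProbabilityMeasure_mix hM
  rw [h1 M hM, integral_indicator_one hB, ofReal_measureReal]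
  exact ((measurePreserving_eval_infinitePi (fun _ : ℕ => mix κ (source ℓ M ω)) j).measure_preimage
    hB.nullMeasurableSet).symm

lemma tendsto_measure_sampleMean (h : IsResampling κ ρ P ℓ X) {f : E → ℝ} (hf : Measurable f)
    (hfi : Integrable f (ρ.bind κ)) {ε : ℝ} (hε : 0 < ε) :
    Tendsto (fun p : ℕ × ℕ => P {ω | ε ≤ |sampleMean f p.2 (fun j => X p.1 j ω) -
      ((ρ.bind κ).real Set.univ)⁻¹ * ∫ x, f x ∂(ρ.bind κ)|}) (atTop ×ˢ atTop) (𝓝 0) := by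
  set m := ((ρ.bind κ).real Set.univ)⁻¹ * ∫ x, f x ∂(ρ.bind κ) with hm
  have hD : ∀ N, MeasurableSet {x : ℕ → E | ε ≤ |sampleMean f N x - m|} := fun N =>
    measurableSet_le measurable_const ((measurable_sampleMean hf N).sub_const m).abs
  have heq : ∀ p : ℕ × ℕ, P {ω | ε ≤ |sampleMean f p.2 (fun j => X p.1 j ω) - m|} =
      ∫⁻ ω, condDistrib (fun ω j => X p.1 j ω) (source ℓ p.1) P (source ℓ p.1 ω)
        {x : ℕ → E | ε ≤ |sampleMean f p.2 x - m|} ∂P := by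
    intro p
    have := setLIntegral_preimage_condDistrib (h.measurable_sources p.1)
      (h.measurable_points p.1).aemeasurable (hD p.2) (μ := P) (t := Set.univ) .univ
    simpa using this.symm
  simp_rw [heq]
  rw [← lintegral_zero (μ := P)]
  refine tendsto_lintegral_filter_of_dominated_convergence (fun _ => 1)
    (Eventually.of_forall fun p => ?_)
    (Eventually.of_forall fun p => ae_of_all _ fun ω => prob_le_one) (by simp) ?_
  · exact ((condDistrib _ _ P).measurable_coe (hD p.2)).comp (h.measurable_sources p.1)
  have hclip : ∀ T : ℕ, Measurable fun y => |f y - clip T (f y)| := fun T =>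
    (hf.sub ((measurable_clip T).comp hf)).abs
  have hclipi : ∀ T : ℕ, Integrable (fun y => |f y - clip T (f y)|) (ρ.bind κ) := fun T =>
    hfi.mono (hclip T).aestronglyMeasurable (ae_of_all _ fun y => by
      simpa using abs_sub_clip_le (Nat.cast_nonneg T) (f y))
  filter_upwards [h.ae_condDistrib_eq, h.ae_eventually_pool_ne_zero,
    h.ae_tendsto_integral_mix hf hfi,
    ae_all_iff.2 fun T => h.ae_tendsto_integral_mix (hclip T) (hclipi T),
    h.ae_forall_source ((Measure.integrable_comp_iff hfi.1).1 hfi).1] with ω h1 h2 h3 h4 h5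
  have he0 : Tendsto (fun T : ℕ => ((ρ.bind κ).real Set.univ)⁻¹ *
      ∫ x, |f x - clip T (f x)| ∂(ρ.bind κ)) atTop (𝓝 0) := by
    simpa using (tendsto_integral_abs_sub_clip hf hfi).const_mul ((ρ.bind κ).real Set.univ)⁻¹
  refine (_root_.tendsto_measure_sampleMean (h2.mono fun M hM => isProbabilityMeasure_mix hM) hf
    (h2.mono fun M hM => integrable_mix hM fun i => h5 i) h3 h4 he0 hε).congr' ?_
  filter_upwards [(h2.prod_inl (atTop : Filter ℕ))] with p hp
  rw [h1 p.1 hp]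

/-- The sample means of an integrable function are consistent, in probability and almost surely. -/
theorem consistent (h : IsResampling κ ρ P ℓ X) {f : E → ℝ} (hfi : Integrable f (ρ.bind κ)) :
    TendstoInMeasure P (fun (p : ℕ × ℕ) ω => sampleMean f p.2 fun j => X p.1 j ω)
      (atTop ×ˢ atTop) (fun _ => ((ρ.bind κ).real Set.univ)⁻¹ * ∫ x, f x ∂(ρ.bind κ)) ∧
    ∀ᵐ ω ∂P, ∃ I : ℕ → ℝ,
      (∀ᶠ M in atTop, Tendsto (fun N => sampleMean f N fun j => X M j ω) atTop (𝓝 (I M))) ∧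
      Tendsto I atTop (𝓝 (((ρ.bind κ).real Set.univ)⁻¹ * ∫ x, f x ∂(ρ.bind κ))) := by
  set g := hfi.1.mk f with hg
  have hgm : Measurable g := hfi.1.stronglyMeasurable_mk.measurable
  have hfg : f =ᵐ[ρ.bind κ] g := hfi.1.ae_eq_mk
  have hgi : Integrable g (ρ.bind κ) := hfi.congr hfg
  rw [integral_congr_ae hfg]
  set W := toMeasurable (ρ.bind κ) {x | f x ≠ g x} with hW
  have hWm : MeasurableSet W := measurableSet_toMeasurable _ _
  have hW0 : ρ.bind κ W = 0 := by rw [hW, measure_toMeasurable]; exact hfg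
  have hmean : ∀ᵐ ω ∂P, ∀ M, pool κ (source ℓ M ω) Set.univ ≠ 0 → ∀ N,
      sampleMean f N (fun j => X M j ω) = sampleMean g N fun j => X M j ω := by
    filter_upwards [h.ae_notMem_null hWm hW0] with ω hω M hM N
    simp only [sampleMean]
    congr 1
    refine Finset.sum_congr rfl fun j _ => ?_
    by_contra hne
    exact hω M hM j (subset_toMeasurable _ _ hne)
  constructor
  · rw [tendstoInMeasure_iff_norm]
    intro ε hε
    -- Where the pool vanishes the points are arbitrary; the probability of this event tends to
    -- zero.
    have hpool : Tendsto (fun M => P {ω | pool κ (source ℓ M ω) Set.univ = 0}) atTop (𝓝 0) := by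
      have hms : ∀ M, MeasurableSet {ω | pool κ (source ℓ M ω) Set.univ = 0} := fun M =>
        (measurable_pool_univ.comp (h.measurable_sources M)) (measurableSet_singleton 0)
      have hz := tendsto_measure_of_ae_tendsto_indicator_of_isFiniteMeasure atTop (μ := P)
        (A := ∅) .empty hms (by
          filter_upwards [h.ae_eventually_pool_ne_zero] with ω hω
          filter_upwards [hω] with M hM
          simpa using hM)
      simpa using hz
    have hsum := (h.tendsto_measure_sampleMean hgm hgi hε).add
      (hpool.comp (tendsto_fst (f := atTop) (g := (atTop : Filter ℕ))))
    rw [add_zero] at hsum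
    refine tendsto_of_tendsto_of_tendsto_of_le_of_le tendsto_const_nhds hsum (fun _ => zero_le)
      fun p => ?_
    refine (measure_mono_ae ?_).trans (measure_union_le _ _)
    filter_upwards [hmean] with ω hω hmem
    by_cases h0 : pool κ (source ℓ p.1 ω) Set.univ = 0
    · exact Or.inr h0
    · left
      change ε ≤ |_|
      rw [← hω p.1 h0]
      exact hmem
  · filter_upwards [hmean, h.ae_tendsto_sampleMean hgm hgi, h.ae_eventually_pool_ne_zero,
      h.ae_tendsto_integral_mix hgm hgi] with ω h1 h2 h3 h4
    refine ⟨_, ?_, h4⟩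
    filter_upwards [h3] with M hM
    exact (h2 M hM).congr fun N => (h1 M hM N).symm

end IsResampling

end Resampling

/-- A measure on sequences whose marginals are products of a fixed law is an infinite product. -/
lemma eq_infinitePi_of_map_restrict {E : Type*} [MeasurableSpace E] {Q : Measure E}
    [IsProbabilityMeasure Q] {ν : Measure (ℕ → E)}
    (h : ∀ N : ℕ, ν.map (fun x (j : Fin N) => x j) = Measure.pi fun _ : Fin N => Q) :
    ν = Measure.infinitePi fun _ : ℕ => Q := by
  classical
  refine Measure.eq_infinitePi _ fun s t ht => ?_
  obtain ⟨N, hN⟩ := s.exists_nat_subset_range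
  let t' : Fin N → Set E := fun j => if (j : ℕ) ∈ s then t j else Set.univ
  have ht' : ∀ j, MeasurableSet (t' j) := fun j => by
    simp only [t']; split_ifs
    exacts [ht j, .univ]
  have hpre : Set.pi (s : Set ℕ) t =
      (fun (x : ℕ → E) (j : Fin N) => x j) ⁻¹' Set.pi Set.univ t' := by
    ext x
    simp only [Set.mem_pi, Finset.mem_coe, Set.mem_preimage, Set.mem_univ, true_imp_iff, t']
    constructor
    · intro hx j
      split_ifs with hj
      exacts [hx j hj, trivial]
    · intro hx j hj
      have := hx ⟨j, Finset.mem_range.1 (hN hj)⟩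
      simpa [hj] using this
  have hres : Measurable fun (x : ℕ → E) (j : Fin N) => x j :=
    measurable_pi_lambda _ fun j => measurable_pi_apply _
  rw [hpre, ← Measure.map_apply hres (MeasurableSet.univ_pi ht'), h, Measure.pi_pi]
  calc ∏ j : Fin N, Q (t' j) = ∏ j ∈ Finset.range N, if j ∈ s then Q (t j) else 1 := by
        rw [Finset.prod_range]
        refine Finset.prod_congr rfl fun j _ => ?_
        simp only [t']
        split_ifs <;> simp
    _ = ∏ j ∈ s, Q (t j) := by
        rw [Finset.prod_ite_mem, Finset.inter_eq_right.2 hN]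

/-! ### From the ray model to the abstract resampling scheme -/

namespace Ray

lemma ae_crossing_eq {S B : Set E3} (hS : IsSurface S) (hBS : B ⊆ S) (hB : IsSigmaCompact B)
    (hnull : surfaceMeasure (S \ B) = 0) :
    ∀ᵐ l ∂(Ray.measure), (l.points ∩ S).Finite ∧
      crossing B l = Measure.count.restrict (l.points ∩ S) := by
  have hfin : surfaceMeasure B ≠ ∞ :=
    ne_top_of_le_ne_top hS.area_lt_top.ne (measure_mono hBS)
  filter_upwards [ae_hitCount_ne_top hB hfin,
    measure_eq_zero_iff_ae_notMem.1 (measure_hits_of_null hnull)] with l h1 h2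
  have heq : l.points ∩ S = l.points ∩ B := by
    refine Set.Subset.antisymm (fun x hx => ⟨hx.1, ?_⟩) (Set.inter_subset_inter_right _ hBS)
    by_contra hxB
    exact h2 ⟨x, hx.1, hx.2, hxB⟩
  rw [heq]
  refine ⟨Measure.count_apply_lt_top.1 (lt_top_iff_ne_top.2 h1), ?_⟩
  rw [crossing, if_neg h1]

lemma crossing_eq_zero {B : Set E3} {l : Ray} (h : l ∉ hits B) : crossing B l = 0 := by
  rw [crossing, Set.not_nonempty_iff_eq_empty.1 h]
  simp

/-- The counting measures on the intersections with a set, as a kernel. -/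
def crossingKernel {B : Set E3} (hB : IsSigmaCompact B) : Kernel Ray E3 :=
  ⟨crossing B, measurable_crossing hB⟩

instance {B : Set E3} (hB : IsSigmaCompact B) (l : Ray) : IsFiniteMeasure (crossingKernel hB l) :=
  inferInstanceAs (IsFiniteMeasure (crossing B l))

/-- Rays outside `L` miss `B`, so restricting to `L` loses no crossing and conditioning only divides
by the measure of `L`. -/
lemma bind_cond_crossing_eq {S B : Set E3} (hS : IsSurface S) (hBS : B ⊆ S)
    (hB : IsSigmaCompact B) (hnull : surfaceMeasure (S \ B) = 0) {L : Set Ray} (hL : IsCompact L)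
    (hSL : ∀ l : Ray, (l.points ∩ S).Nonempty → l ∈ L) :
    (ProbabilityTheory.cond Ray.measure L).bind (crossingKernel hB) =
      ((Ray.measure L)⁻¹ * croftonConst) • surfaceMeasure.restrict S := by
  rw [mul_smul, ← bind_crossing_eq hS hBS hB hnull]
  ext C hC
  rw [Measure.bind_apply hC (crossingKernel hB).aemeasurable, ProbabilityTheory.cond,
    lintegral_smul_measure, Measure.smul_apply,
    Measure.bind_apply hC (measurable_crossing hB).aemeasurable,
    ← lintegral_indicator hL.measurableSet]
  congr 1
  refine lintegral_congr fun l => ?_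
  by_cases hl : l ∈ L
  · rw [Set.indicator_of_mem hl]; rfl
  · have : l ∉ hits B := fun h => hl (hSL l (hits_mono hBS h))
    rw [Set.indicator_of_notMem hl, crossing_eq_zero this]
    simp

end Ray

lemma numHits_eq_count {S : Set E3} {l : Ray} (h : (l.points ∩ S).Finite) :
    (Ray.numHits S l : ℝ≥0∞) = Measure.count (l.points ∩ S) := by
  rw [Ray.numHits, Measure.count_apply_finite _ h, Set.ncard_eq_toFinset_card _ h]

/-- The factor `k(r i)` in the probability of the ray cancels the `1 / k(r i)` of the uniform choice
on it, so every intersection gets weight `1 / ∑ l, k(r l)`. -/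
lemma map_snd_resampleLaw {S B : Set E3} (hS : MeasurableSet S) (hB : IsSigmaCompact B) {M : ℕ}
    {r : Fin M → Ray}
    (hr : ∀ i, ((r i).points ∩ S).Finite ∧
      Ray.crossing B (r i) = Measure.count.restrict ((r i).points ∩ S)) :
    (resampleLaw S r).map Prod.snd = mix (Ray.crossingKernel hB) r := by
  have hk : ∀ i, Ray.crossingKernel hB (r i) = Measure.count.restrict ((r i).points ∩ S) :=
    fun i => (hr i).2
  have hpool : pool (Ray.crossingKernel hB) r Set.univ =
      ∑ l, (Ray.numHits S (r l) : ℝ≥0∞) := by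
    rw [pool_apply]
    refine Finset.sum_congr rfl fun i _ => ?_
    rw [hk, Measure.restrict_apply_univ, numHits_eq_count (hr i).1]
  ext C hC
  rw [Measure.map_apply measurable_snd hC, mix, Measure.smul_apply, hpool, pool_apply, smul_eq_mul,
    Finset.mul_sum, resampleLaw, Measure.finsetSum_apply]
  refine Finset.sum_congr rfl fun i _ => ?_
  have hA : MeasurableSet ((r i).points ∩ S) := (r i).measurableSet_points.inter hS
  have hpre : (Prod.snd ⁻¹' C : Set (Ray × E3)) = Set.univ ×ˢ C := by ext; simp
  rw [Measure.smul_apply, hpre, Measure.prod_prod, measure_univ, one_mul, smul_eq_mul,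
    numHits_eq_count (hr i).1, hk, Measure.restrict_apply hC, uniformOn, cond_apply hA,
    ENNReal.div_eq_inv_mul, mul_assoc, Set.inter_comm C]
  congr 1
  rcases Set.eq_empty_or_nonempty ((r i).points ∩ S) with h | h
  · simp [h]
  · rw [← mul_assoc, ENNReal.mul_inv_cancel, one_mul]
    · exact (lt_of_lt_of_le one_pos (Ray.one_le_count h)).ne'
    · exact (Measure.count_apply_lt_top.2 (hr i).1).ne

lemma isResampling_crossingKernel {S B : Set E3} (hS : IsSurface S) (hBS : B ⊆ S)
    (hB : IsSigmaCompact B) (hnull : surfaceMeasure (S \ B) = 0) {L : Set Ray}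
    {Ω : Type*} [MeasurableSpace Ω] {P : Measure Ω} [IsProbabilityMeasure P]
    {ℓ : ℕ → Ω → Ray} (hℓ : ∀ i, Measurable (ℓ i)) (hindep : iIndepFun ℓ P)
    (hunif : ∀ i, pdf.IsUniform (ℓ i) L P Ray.measure)
    {R : ℕ → ℕ → Ω → Ray} (hR : ∀ M j, Measurable (R M j))
    {X : ℕ → ℕ → Ω → E3} (hX : ∀ M j, Measurable (X M j))
    (hresample : ∀ M N : ℕ, ∀ᵐ r ∂(P.map fun ω (i : Fin M) => ℓ i ω),
      (∑ i, Ray.numHits S (r i)) ≠ 0 →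
        condDistrib (fun ω (j : Fin N) => (R M j ω, X M j ω)) (fun ω (i : Fin M) => ℓ i ω) P r =
          Measure.pi fun _ : Fin N => resampleLaw S r) :
    IsResampling (Ray.crossingKernel hB) (ProbabilityTheory.cond Ray.measure L) P ℓ X where
  measurable_source := hℓ
  iIndepFun := hindep
  map_eq := hunif
  measurable_point := hX
  condDistrib_eq M := by
    have hsrc : Measurable fun ω (i : Fin M) => ℓ i ω := measurable_pi_lambda _ fun i => hℓ i
    have hpts : Measurable fun ω (j : ℕ) => X M j ω := measurable_pi_lambda _ fun j => hX M j
    have hgood : ∀ᵐ r ∂(P.map fun ω (i : Fin M) => ℓ i ω), ∀ i, ((r i).points ∩ S).Finite ∧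
        Ray.crossing B (r i) = Measure.count.restrict ((r i).points ∩ S) := by
      rw [ae_all_iff]
      intro i
      refine ae_of_ae_map (f := fun r : Fin M → Ray => r i)
        (p := fun l : Ray => (l.points ∩ S).Finite ∧
          Ray.crossing B l = Measure.count.restrict (l.points ∩ S))
        (measurable_pi_apply i).aemeasurable ?_
      rw [Measure.map_map (measurable_pi_apply i) hsrc]
      have : P.map ((fun r : Fin M → Ray => r i) ∘ fun ω (i : Fin M) => ℓ i ω) =
          ProbabilityTheory.cond Ray.measure L := hunif i
      rw [this]
      exact cond_absolutelyContinuous.ae_le (Ray.ae_crossing_eq hS hBS hB hnull)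
    -- The resampling law is prescribed for finitely many pairs at a time. Both conditional laws
    -- project to that of the first `N` points, and countably many `N` share one null set.
    have hmarg : ∀ᵐ r ∂(P.map fun ω (i : Fin M) => ℓ i ω), ∀ N : ℕ,
        (condDistrib (fun ω j => X M j ω) (fun ω (i : Fin M) => ℓ i ω) P r).map
            (fun x (j : Fin N) => x j) =
          (condDistrib (fun ω (j : Fin N) => (R M j ω, X M j ω)) (fun ω (i : Fin M) => ℓ i ω) P
            r).map (fun v j => (v j).2) := by
      rw [ae_all_iff]
      intro N
      have hpairs : Measurable fun ω (j : Fin N) => (R M j ω, X M j ω) :=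
        measurable_pi_lambda _ fun j => (hR M j).prodMk (hX M j)
      have hm1 : Measurable fun (x : ℕ → E3) (j : Fin N) => x j :=
        measurable_pi_lambda _ fun j => measurable_pi_apply _
      have hm2 : Measurable fun (v : Fin N → Ray × E3) (j : Fin N) => (v j).2 :=
        measurable_pi_lambda _ fun j => measurable_snd.comp (measurable_pi_apply j)
      have h1 := condDistrib_comp (mβ := inferInstance) (μ := P) (fun ω (i : Fin M) => ℓ i ω)
        hpts.aemeasurable hm1
      have h2 := condDistrib_comp (mβ := inferInstance) (μ := P) (fun ω (i : Fin M) => ℓ i ω)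
        hpairs.aemeasurable hm2
      filter_upwards [h1, h2] with r e1 e2
      rw [Kernel.map_apply _ hm1] at e1
      rw [Kernel.map_apply _ hm2] at e2
      rw [← e1, ← e2]
      rfl
    filter_upwards [hgood, hmarg, ae_all_iff.2 (hresample M)] with r h1 h2 h3 h0
    have hsnd := map_snd_resampleLaw hS.measurableSet hB h1
    have hprob := isProbabilityMeasure_mix h0
    have hne : (∑ i, Ray.numHits S (r i)) ≠ 0 := by
      intro hz
      apply h0
      rw [pool_apply]
      refine Finset.sum_eq_zero fun i hi => ?_
      change Ray.crossing B (r i) Set.univ = 0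
      rw [(h1 i).2, Measure.restrict_apply_univ, ← numHits_eq_count (h1 i).1,
        Finset.sum_eq_zero_iff.1 hz i hi, Nat.cast_zero]
    have hprob' : IsProbabilityMeasure (resampleLaw S r) := by
      refine ⟨?_⟩
      rw [← Set.preimage_univ (f := Prod.snd), ← Measure.map_apply measurable_snd .univ, hsnd,
        measure_univ]
    refine eq_infinitePi_of_map_restrict fun N => ?_
    rw [h2 N, h3 N hne]
    have : ∀ _ : Fin N, SigmaFinite ((resampleLaw S r).map Prod.snd) := fun _ => by
      rw [hsnd]; infer_instance
    have hpi := Measure.pi_map_pi (μ := fun _ : Fin N => resampleLaw S r)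
      (f := fun _ => Prod.snd) (fun _ => measurable_snd.aemeasurable)
    rw [hpi, hsnd]

end

theorem mainTheorem1
    (S : Set E3) (hS : IsSurface S)
    -- a compact set of rays that contains all rays meeting `S`
    (L : Set Ray) (hL : IsCompact L) (hSL : ∀ l : Ray, (l.points ∩ S).Nonempty → l ∈ L)
    {Ω : Type*} [MeasurableSpace Ω] (P : Measure Ω) [IsProbabilityMeasure P]
    -- independent rays, uniformly distributed in `L`
    (ℓ : ℕ → Ω → Ray) (hℓ : ∀ i, Measurable (ℓ i)) (hindep : iIndepFun ℓ P)
    (hunif : ∀ i, pdf.IsUniform (ℓ i) L P Ray.measure)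
    -- `R M j` and `X M j`: the `j`-th ray resampled from the first `M` rays, and the intersection
    -- of this ray with `S` that is selected
    (R : ℕ → ℕ → Ω → Ray) (hR : ∀ M j, Measurable (R M j))
    (X : ℕ → ℕ → Ω → E3) (hX : ∀ M j, Measurable (X M j))
    -- given the first `M` rays, not all of which miss `S`, the first `N` pairs are independent with
    -- the law of the resampling step
    (hresample : ∀ M N : ℕ, ∀ᵐ r ∂(P.map fun ω (i : Fin M) => ℓ i ω),
      (∑ i, Ray.numHits S (r i)) ≠ 0 →
        condDistrib (fun ω (j : Fin N) => (R M j ω, X M j ω)) (fun ω (i : Fin M) => ℓ i ω) P r =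
          Measure.pi fun _ : Fin N => resampleLaw S r) :
    -- the points are asymptotically uniformly distributed on `S`
    (∀ (j : ℕ) (B : Set E3), MeasurableSet B →
      Tendsto (fun M => P {ω | X M j ω ∈ B}) atTop
        (𝓝 (surfaceMeasure (B ∩ S) / surfaceMeasure S))) ∧
    ∀ f : E3 → ℝ, IntegrableOn f S surfaceMeasure →
      -- the estimator is consistent: it converges in probability as `M, N → ∞`
      TendstoInMeasure P
        (fun (p : ℕ × ℕ) ω => uniformEstimator S f (fun j => X p.1 j ω) p.2) (atTop ×ˢ atTop)
        (fun _ => ∫ x in S, f x ∂surfaceMeasure) ∧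
      -- almost surely it converges as `N → ∞` for all large `M`, and the limit tends to the
      -- integral as `M → ∞`
      ∀ᵐ ω ∂P, ∃ I : ℕ → ℝ,
        (∀ᶠ M in atTop, Tendsto (fun N => uniformEstimator S f (fun j => X M j ω) N) atTop
          (𝓝 (I M))) ∧
        Tendsto I atTop (𝓝 (∫ x in S, f x ∂surfaceMeasure)) := by
  have hfinS : IsFiniteMeasure (surfaceMeasure.restrict S) :=
    ⟨by simpa using hS.area_lt_top⟩
  -- Area is not σ-finite on `ℝ³`; its restriction to `S` is finite and hence inner regular.
  obtain ⟨B, hBS, hB, hnull'⟩ := hS.measurableSet.exists_isSigmaCompact_diff_null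
    (measure_ne_top (surfaceMeasure.restrict S) S)
  have hnull : surfaceMeasure (S \ B) = 0 := by
    rwa [Measure.restrict_apply (hS.measurableSet.diff hB.measurableSet),
      Set.inter_eq_left.2 Set.sdiff_subset] at hnull'
  have hres := isResampling_crossingKernel hS hBS hB hnull hℓ hindep hunif hR hX hresample
  have hbind := Ray.bind_cond_crossing_eq hS hBS hB hnull hL hSL
  -- If `L` had measure `0` or `∞`, the conditional measure would vanish and could not be the law of
  -- `ℓ 0`.
  have huniv : (Ray.measure L)⁻¹ * Ray.measure L = 1 := by
    have h1 : (P.map (ℓ 0)) Set.univ = 1 :=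
      (Measure.isProbabilityMeasure_map (hℓ 0).aemeasurable).measure_univ
    rw [show P.map (ℓ 0) = _ from hunif 0, cond_apply hL.measurableSet, Set.inter_univ] at h1
    exact h1
  have hL0 : Ray.measure L ≠ 0 := fun h => by simp [h] at huniv
  have hLtop : Ray.measure L ≠ ∞ := fun h => by simp [h] at huniv
  set a := (Ray.measure L)⁻¹ * croftonConst with ha
  have ha0 : a ≠ 0 := mul_ne_zero (ENNReal.inv_ne_zero.2 hLtop) croftonConst_ne_zero
  have hatop : a ≠ ∞ := ENNReal.mul_ne_top (ENNReal.inv_ne_top.2 hL0) croftonConst_ne_top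
  have : IsFiniteMeasure
      ((ProbabilityTheory.cond Ray.measure L).bind (Ray.crossingKernel hB)) := by
    rw [hbind]; exact Measure.smul_finite _ hatop
  have : NeZero ((ProbabilityTheory.cond Ray.measure L).bind (Ray.crossingKernel hB)) := by
    refine ⟨fun h => ?_⟩
    rw [hbind] at h
    have h' := congrArg (fun μ : Measure E3 => μ Set.univ) h
    simp [ha0, hS.area_pos.ne'] at h'
  constructor
  · intro j C hC
    have h := hres.tendsto_measure_point j hC
    rwa [hbind, Measure.smul_apply, Measure.smul_apply, Measure.restrict_apply hC,
      Measure.restrict_apply_univ, smul_eq_mul, smul_eq_mul,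
      ENNReal.mul_div_mul_left _ _ ha0 hatop] at h
  · intro f hf
    have hest : ∀ (x : ℕ → E3) (N : ℕ),
        uniformEstimator S f x N = sampleMean (fun y => area S * f y) N x := fun x N => by
      rw [uniformEstimator, sampleMean, one_div, inv_mul_eq_div]
    have hInt : Integrable (fun y => area S * f y)
        ((ProbabilityTheory.cond Ray.measure L).bind (Ray.crossingKernel hB)) := by
      rw [hbind]
      exact (Integrable.const_mul hf _).smul_measure hatop
    have harea : area S ≠ 0 := (ENNReal.toReal_pos hS.area_pos.ne' hS.area_lt_top.ne).ne'
    have har : a.toReal ≠ 0 := (ENNReal.toReal_pos ha0 hatop).ne'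
    have hlim : (((ProbabilityTheory.cond Ray.measure L).bind
        (Ray.crossingKernel hB)).real Set.univ)⁻¹ *
        ∫ x, area S * f x ∂((ProbabilityTheory.cond Ray.measure L).bind (Ray.crossingKernel hB)) =
        ∫ x in S, f x ∂surfaceMeasure := by
      rw [hbind, integral_smul_measure, integral_const_mul, measureReal_ennreal_smul_apply,
        measureReal_restrict_apply_univ, smul_eq_mul]
      change (a.toReal * area S)⁻¹ * _ = _
      field_simp
    have h := hres.consistent hInt
    rw [hlim] at h
    simp_rw [hest]
    exact h
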